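/- Let $0<\alpha<1$. There is a constant $c>0$, depending only on $\alpha$ (in particular independent of the triangulation and its mesh size $h$, of $\Omega$, $T$, $\tau$, $n$ and $v$), such that the following holds. Let $\Omega\subset\mathbb R^d$, $d\in\{1,2,3\}$, be a bounded convex polygonal (polyhedral) domain, let $T>0$, $N\ge 1$, $\tau=T/N$ and $t_n=n\tau$, and let $A=-\Delta$ with homogeneous Dirichlet boundary condition and domain $D(A)=H^2(\Omega)\cap H^1_0(\Omega)$. Let $\mathcal T_h$ be a (conforming) triangulation of $\Omega$ into finitely many $d$-simplexes and $$X_h=\{v_h\in H^1_0(\Omega): v_h|_K \text{ is a linear (affine) function for every } K\in\mathcal T_h\}.$$ Define $R_h:H^1_0(\Omega)\to X_h$ by $(\nabla R_h\varphi,\nabla\chi)=(\nabla\varphi,\nabla\chi)$ for all $\chi\in X_h$, and $A_h:X_h\to X_h$ by $(A_h\varphi,\chi)=(\nabla\varphi,\nabla\chi)$ for all $\varphi,\chi\in X_h$, where $(\cdot,\cdot)$ is the $L^2(\Omega)$ inner product. Let $v\in H^2(\Omega)\cap H^1_0(\Omega)$. Let $u_h:[0,T]\to X_h$ be the solution of the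 semidiscrete problem with zero source term $$\partial_t^\alpha u_h(t)+A_hu_h(t)=0,\quad 0<t\le T,\qquad u_h(0)=R_hv,$$ where $\partial_t^\alpha u(t)=\frac1{\Gamma(1-\alpha)}\int_0^t(t-s)^{-\alpha}u'(s)\,ds$ is the Caputo derivative ($u_h$ is continuous on $[0,T]$ and differentiable on $(0,T)$, and these integrals converge absolutely). Let $U_h^0=R_hv$ and let $U_h^1,\dots,U_h^N\in X_h$ be the solution of the fully discrete L1 scheme $$(b_0I+\tau^\alpha A_h)U_h^n=b_{n-1}U_h^0+\sum_{j=1}^{n-1}(b_{j-1}-b_j)U_h^{n-j},\qquad n=1,\dots,N,$$ with $b_j=\big((j+1)^{1-\alpha}-j^{1-\alpha}\big)/\Gamma(2-\alpha)$. Then $$\|u_h(t_n)-U_h^n\|_{L^2(\Omega)}\le c\,\tau\,t_n^{\alpha-1}\,\|Av\|_{L^2(\Omega)},\qquad n=1,\dots,N.$$ -/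

import Mathlib

open MeasureTheory TopologicalSpace
open scoped ContDiff

noncomputable section

namespace Subdiffusion

/-! ### Domains, Lebesgue and Sobolev spaces -/

/-- `ℝ^d` with its Euclidean norm. -/
abbrev Space (d : ℕ) : Type := EuclideanSpace ℝ (Fin d)

/-- A bounded convex polygonal (polyhedral) domain: a nonempty open set that is the interior of
the convex hull of finitely many points. -/
def IsConvexPolygonalDomain {d : ℕ} (Ω : Opens (Space d)) : Prop :=
  (Ω : Set (Space d)).Nonempty ∧
    ∃ s : Finset (Space d), (Ω : Set (Space d)) = interior (convexHull ℝ (s : Set (Space d)))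

/-- The real Hilbert space `L²(Ω)`. -/
abbrev L2 {d : ℕ} (Ω : Opens (Space d)) : Type :=
  Lp ℝ 2 ((volume : Measure (Space d)).restrict (Ω : Set (Space d)))

/-- `φ` is a test function on `Ω`, i.e. `φ ∈ C_c^∞(Ω)`. -/
def IsTestFunction {d : ℕ} (Ω : Opens (Space d)) (φ : Space d → ℝ) : Prop :=
  ContDiff ℝ ∞ φ ∧ HasCompactSupport φ ∧ tsupport φ ⊆ (Ω : Set (Space d))

/-- The classical partial derivative `∂φ/∂x_i`. -/
def classicalPartial {d : ℕ} (i : Fin d) (φ : Space d → ℝ) (x : Space d) : ℝ :=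
  fderiv ℝ φ x (EuclideanSpace.single i 1)

/-- `g ∈ L²(Ω)` is the weak partial derivative of `u ∈ L²(Ω)` in the direction `x_i`. -/
def HasWeakPartial {d : ℕ} {Ω : Opens (Space d)} (i : Fin d) (u g : L2 Ω) : Prop :=
  ∀ φ : Space d → ℝ, IsTestFunction Ω φ →
    ∫ x in (Ω : Set (Space d)), u x * classicalPartial i φ x =
      -∫ x in (Ω : Set (Space d)), g x * φ x

open Classical in
/-- The weak partial derivative `∂u/∂x_i ∈ L²(Ω)` (and `0` if there is none in `L²(Ω)`). -/
def weakPartial {d : ℕ} {Ω : Opens (Space d)} (i : Fin d) (u : L2 Ω) : L2 Ω :=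
  if h : ∃ g : L2 Ω, HasWeakPartial i u g then h.choose else 0

section Facts

variable {d : ℕ} {Ω : Opens (Space d)}

lemma IsTestFunction.memLp {φ : Space d → ℝ} (hφ : IsTestFunction Ω φ) :
    MemLp φ 2 ((volume : Measure (Space d)).restrict (Ω : Set (Space d))) :=
  (hφ.1.continuous.memLp_of_hasCompactSupport hφ.2.1).restrict _

lemma IsTestFunction.memLp_partial {φ : Space d → ℝ} (hφ : IsTestFunction Ω φ) (i : Fin d) :
    MemLp (classicalPartial i φ) 2
      ((volume : Measure (Space d)).restrict (Ω : Set (Space d))) := by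
  have hc : Continuous (classicalPartial i φ) :=
    (hφ.1.continuous_fderiv (by simp)).clm_apply continuous_const
  have hs : HasCompactSupport (classicalPartial i φ) :=
    hφ.2.1.fderiv_apply (𝕜 := ℝ) (EuclideanSpace.single i 1)
  exact (hc.memLp_of_hasCompactSupport hs).restrict _

lemma IsTestFunction.add {φ ψ : Space d → ℝ} (hφ : IsTestFunction Ω φ)
    (hψ : IsTestFunction Ω ψ) : IsTestFunction Ω (φ + ψ) :=
  ⟨hφ.1.add hψ.1, hφ.2.1.add hψ.2.1,
    (tsupport_add φ ψ).trans (Set.union_subset hφ.2.2 hψ.2.2)⟩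

lemma IsTestFunction.const_smul {φ : Space d → ℝ} (a : ℝ) (hφ : IsTestFunction Ω φ) :
    IsTestFunction Ω (a • φ) :=
  ⟨contDiff_const.smul hφ.1, hφ.2.1.smul_left (f := fun _ => a),
    (tsupport_smul_subset_right (fun _ => a) φ).trans hφ.2.2⟩

lemma integrable_mul (u : L2 Ω) {φ : Space d → ℝ}
    (hφ : MemLp φ 2 ((volume : Measure (Space d)).restrict (Ω : Set (Space d)))) :
    Integrable (fun x => u x * φ x)
      ((volume : Measure (Space d)).restrict (Ω : Set (Space d))) :=
  (Lp.memLp u).integrable_mul hφ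

lemma integral_add_mul (u v : L2 Ω) {φ : Space d → ℝ}
    (hφ : MemLp φ 2 ((volume : Measure (Space d)).restrict (Ω : Set (Space d)))) :
    ∫ x in (Ω : Set (Space d)), (u + v : L2 Ω) x * φ x =
      (∫ x in (Ω : Set (Space d)), u x * φ x) + ∫ x in (Ω : Set (Space d)), v x * φ x := by
  rw [← integral_add (integrable_mul u hφ) (integrable_mul v hφ)]
  refine integral_congr_ae ?_
  filter_upwards [Lp.coeFn_add u v] with x hx
  rw [hx, Pi.add_apply, add_mul]

lemma integral_smul_mul (a : ℝ) (u : L2 Ω) (φ : Space d → ℝ) :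
    ∫ x in (Ω : Set (Space d)), (a • u : L2 Ω) x * φ x =
      a * ∫ x in (Ω : Set (Space d)), u x * φ x := by
  rw [← integral_const_mul]
  refine integral_congr_ae ?_
  filter_upwards [Lp.coeFn_smul a u] with x hx
  rw [hx, Pi.smul_apply, smul_eq_mul, mul_assoc]

lemma HasWeakPartial.add {i : Fin d} {u v g k : L2 Ω} (h₁ : HasWeakPartial i u g)
    (h₂ : HasWeakPartial i v k) : HasWeakPartial i (u + v) (g + k) := by
  intro φ hφ
  rw [integral_add_mul u v (hφ.memLp_partial i), integral_add_mul g k hφ.memLp, h₁ φ hφ,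
    h₂ φ hφ]
  ring

lemma HasWeakPartial.smul {i : Fin d} {u g : L2 Ω} (a : ℝ) (h : HasWeakPartial i u g) :
    HasWeakPartial i (a • u) (a • g) := by
  intro φ hφ
  rw [integral_smul_mul, integral_smul_mul, h φ hφ]
  ring

lemma HasWeakPartial.unique {i : Fin d} {u g k : L2 Ω} (h₁ : HasWeakPartial i u g)
    (h₂ : HasWeakPartial i u k) : g = k := by
  have h0 : HasWeakPartial i ((0 : ℝ) • u) (g + (-1 : ℝ) • k) := by
    have := h₁.add (h₂.smul (-1))
    have hu : u + (-1 : ℝ) • u = (0 : ℝ) • u := by module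
    rwa [hu] at this
  have hloc : LocallyIntegrableOn (fun x => (g + (-1 : ℝ) • k : L2 Ω) x) (Ω : Set (Space d))
      (volume : Measure (Space d)) := by
    have hm := Lp.memLp (g + (-1 : ℝ) • k : L2 Ω)
    have : LocallyIntegrable (fun x => (g + (-1 : ℝ) • k : L2 Ω) x)
        ((volume : Measure (Space d)).restrict (Ω : Set (Space d))) :=
      hm.locallyIntegrable (by norm_num)
    exact locallyIntegrableOn_of_locallyIntegrable_restrict this
  have hz := Ω.isOpen.ae_eq_zero_of_integral_contDiff_smul_eq_zero hloc (by
    intro φ h1 h2 h3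
    have e := h0 φ ⟨h1, h2, h3⟩
    rw [integral_smul_mul, zero_mul, eq_comm, neg_eq_zero] at e
    rw [← e, ← setIntegral_eq_integral_of_forall_compl_eq_zero (s := (Ω : Set (Space d)))]
    · refine integral_congr_ae (Filter.Eventually.of_forall fun x => ?_)
      simp [mul_comm]
    · intro x hx
      have : φ x = 0 := image_eq_zero_of_notMem_tsupport fun hx' => hx (h3 hx')
      simp [this])
  have hgk : g + (-1 : ℝ) • k = 0 := by
    rw [Lp.eq_zero_iff_ae_eq_zero]
    exact (ae_restrict_iff' Ω.isOpen.measurableSet).2 hz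
  have h' : g = (g + (-1 : ℝ) • k) + k := by module
  rw [h', hgk, zero_add]

lemma HasWeakPartial.weakPartial_eq {i : Fin d} {u g : L2 Ω} (h : HasWeakPartial i u g) :
    weakPartial i u = g := by
  have he : ∃ g : L2 Ω, HasWeakPartial i u g := ⟨g, h⟩
  rw [weakPartial, dif_pos he]
  exact he.choose_spec.unique h

end Facts

/-- The Sobolev space `H¹(Ω)`. -/
def H1 {d : ℕ} (Ω : Opens (Space d)) : Submodule ℝ (L2 Ω) where
  carrier := {u | ∀ i : Fin d, ∃ g : L2 Ω, HasWeakPartial i u g}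
  add_mem' hu hv i := ⟨_, (hu i).choose_spec.add (hv i).choose_spec⟩
  zero_mem' i := ⟨0, by
    have h : HasWeakPartial i ((0 : ℝ) • (0 : L2 Ω)) ((0 : ℝ) • (0 : L2 Ω)) := by
      intro φ _
      rw [integral_smul_mul, integral_smul_mul]
      simp
    simpa using h⟩
  smul_mem' a _ hu i := ⟨_, (hu i).choose_spec.smul a⟩

lemma hasWeakPartial_weakPartial {d : ℕ} {Ω : Opens (Space d)} {u : L2 Ω} (hu : u ∈ H1 Ω)
    (i : Fin d) : HasWeakPartial i u (weakPartial i u) := by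
  rw [(hu i).choose_spec.weakPartial_eq]
  exact (hu i).choose_spec

lemma weakPartial_add {d : ℕ} {Ω : Opens (Space d)} {u v : L2 Ω} (hu : u ∈ H1 Ω)
    (hv : v ∈ H1 Ω) (i : Fin d) : weakPartial i (u + v) = weakPartial i u + weakPartial i v :=
  ((hasWeakPartial_weakPartial hu i).add (hasWeakPartial_weakPartial hv i)).weakPartial_eq

lemma weakPartial_smul {d : ℕ} {Ω : Opens (Space d)} {u : L2 Ω} (a : ℝ) (hu : u ∈ H1 Ω)
    (i : Fin d) : weakPartial i (a • u) = a • weakPartial i u :=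
  ((hasWeakPartial_weakPartial hu i).smul a).weakPartial_eq

/-- The weak gradient `∇ : H¹(Ω) → L²(Ω)^d`. -/
def grad {d : ℕ} (Ω : Opens (Space d)) : H1 Ω →ₗ[ℝ] PiLp 2 (fun _ : Fin d => L2 Ω) where
  toFun u := WithLp.toLp 2 (fun i => weakPartial i (u : L2 Ω))
  map_add' u v := by
    ext1 i
    simpa using weakPartial_add u.2 v.2 i
  map_smul' a u := by
    ext1 i
    simpa using weakPartial_smul a u.2 i

/-- The Sobolev space `H¹₀(Ω)`: the closure of `C_c^∞(Ω)` in `H¹(Ω)`. -/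
def H10 {d : ℕ} (Ω : Opens (Space d)) : Submodule ℝ (L2 Ω) where
  carrier := {u | u ∈ H1 Ω ∧ ∀ ε : ENNReal, 0 < ε → ∃ φ : Space d → ℝ, IsTestFunction Ω φ ∧
    eLpNorm (fun x => u x - φ x) 2 (volume.restrict (Ω : Set (Space d))) < ε ∧
    ∀ i : Fin d, eLpNorm (fun x => weakPartial i u x - classicalPartial i φ x) 2
      (volume.restrict (Ω : Set (Space d))) < ε}
  add_mem' := by
    rintro u v ⟨hu, hu'⟩ ⟨hv, hv'⟩
    refine ⟨(H1 Ω).add_mem hu hv, fun ε hε => ?_⟩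
    have hε2 : 0 < ε / 2 := ENNReal.half_pos hε.ne'
    obtain ⟨φ, hφ, h1, h2⟩ := hu' _ hε2
    obtain ⟨ψ, hψ, h3, h4⟩ := hv' _ hε2
    have key : ∀ (w z : L2 Ω) (f g : Space d → ℝ),
        MemLp f 2 (volume.restrict (Ω : Set (Space d))) →
        MemLp g 2 (volume.restrict (Ω : Set (Space d))) →
        eLpNorm (fun x => w x - f x) 2 (volume.restrict (Ω : Set (Space d))) < ε / 2 →
        eLpNorm (fun x => z x - g x) 2 (volume.restrict (Ω : Set (Space d))) < ε / 2 →
        eLpNorm (fun x => (w + z : L2 Ω) x - (f x + g x)) 2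
          (volume.restrict (Ω : Set (Space d))) < ε := by
      intro w z f g hf hg h5 h6
      have e : (fun x => (w + z : L2 Ω) x - (f x + g x)) =ᵐ[volume.restrict (Ω : Set (Space d))]
          (fun x => w x - f x) + (fun x => z x - g x) := by
        filter_upwards [Lp.coeFn_add w z] with x hx
        simp only [hx, Pi.add_apply]
        ring
      rw [eLpNorm_congr_ae e]
      refine (eLpNorm_add_le ((Lp.memLp w).sub hf).1 ((Lp.memLp z).sub hg).1
        (by norm_num)).trans_lt ?_
      rw [← ENNReal.add_halves ε]
      exact ENNReal.add_lt_add h5 h6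
    refine ⟨φ + ψ, hφ.add hψ, key u v φ ψ hφ.memLp hψ.memLp h1 h3, fun i => ?_⟩
    rw [weakPartial_add hu hv]
    have e : classicalPartial i (φ + ψ) =
        fun x => classicalPartial i φ x + classicalPartial i ψ x := by
      ext x
      simp only [classicalPartial]
      rw [fderiv_add (hφ.1.differentiable (by simp) x) (hψ.1.differentiable (by simp) x)]
      rfl
    rw [e]
    exact key _ _ _ _ (hφ.memLp_partial i) (hψ.memLp_partial i) (h2 i) (h4 i)
  zero_mem' := by
    refine ⟨(H1 Ω).zero_mem, fun ε hε => ⟨0, ⟨contDiff_const, HasCompactSupport.zero, by simp⟩,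
      ?_, fun i => ?_⟩⟩
    · have e : (fun x => (0 : L2 Ω) x - (0 : Space d → ℝ) x)
          =ᵐ[volume.restrict (Ω : Set (Space d))] 0 := by
        filter_upwards [Lp.coeFn_zero ℝ 2 (volume.restrict (Ω : Set (Space d)))] with x hx
        simp only [hx]
        simp
      rw [eLpNorm_congr_ae e]
      simpa using hε
    · have hw : weakPartial i (0 : L2 Ω) = 0 := by
        have := weakPartial_smul (0 : ℝ) (H1 Ω).zero_mem i
        simpa using this
      rw [hw]
      have e : (fun x => (0 : L2 Ω) x - classicalPartial i (0 : Space d → ℝ) x)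
          =ᵐ[volume.restrict (Ω : Set (Space d))] 0 := by
        filter_upwards [Lp.coeFn_zero ℝ 2 (volume.restrict (Ω : Set (Space d)))] with x hx
        simp only [hx]
        simp [classicalPartial]
      rw [eLpNorm_congr_ae e]
      simpa using hε
  smul_mem' := by
    rintro a u ⟨hu, hu'⟩
    refine ⟨(H1 Ω).smul_mem a hu, fun ε hε => ?_⟩
    obtain ⟨δ, hδ, hδε⟩ : ∃ δ : ENNReal, 0 < δ ∧ ‖a‖ₑ * δ < ε := by
      rcases eq_or_ne ε ⊤ with rfl | hε'
      · exact ⟨1, one_pos, by simp⟩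
      have hn : ‖a‖ₑ + 1 ≠ ⊤ := by simp
      refine ⟨ε / (‖a‖ₑ + 1) / 2, ENNReal.half_pos (ENNReal.div_pos hε.ne' hn).ne', ?_⟩
      have h0 : ε / (‖a‖ₑ + 1) ≠ 0 := (ENNReal.div_pos hε.ne' hn).ne'
      have ht : ε / (‖a‖ₑ + 1) ≠ ⊤ := ENNReal.div_ne_top hε' (by simp)
      calc ‖a‖ₑ * (ε / (‖a‖ₑ + 1) / 2) ≤ (‖a‖ₑ + 1) * (ε / (‖a‖ₑ + 1) / 2) := by
            gcongr
            exact le_self_add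
        _ < (‖a‖ₑ + 1) * (ε / (‖a‖ₑ + 1)) :=
            ENNReal.mul_lt_mul_right (by simp) hn (ENNReal.half_lt_self h0 ht)
        _ = ε := ENNReal.mul_div_cancel (by simp) hn
    obtain ⟨φ, hφ, h1, h2⟩ := hu' δ hδ
    have key : ∀ (w : L2 Ω) (f : Space d → ℝ),
        eLpNorm (fun x => w x - f x) 2 (volume.restrict (Ω : Set (Space d))) < δ →
        eLpNorm (fun x => (a • w : L2 Ω) x - a * f x) 2
          (volume.restrict (Ω : Set (Space d))) < ε := by
      intro w f h
      have e : (fun x => (a • w : L2 Ω) x - a * f x) =ᵐ[volume.restrict (Ω : Set (Space d))]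
          a • (fun x => w x - f x) := by
        filter_upwards [Lp.coeFn_smul a w] with x hx
        simp only [hx, Pi.smul_apply, smul_eq_mul]
        ring
      rw [eLpNorm_congr_ae e, eLpNorm_const_smul]
      refine lt_of_le_of_lt ?_ hδε
      gcongr
    refine ⟨a • φ, hφ.const_smul a, key u φ h1, fun i => ?_⟩
    rw [weakPartial_smul a hu]
    have e : classicalPartial i (a • φ) = fun x => a * classicalPartial i φ x := by
      ext x
      simp only [classicalPartial]
      rw [fderiv_const_smul (hφ.1.differentiable (by simp) x)]
      rfl
    rw [e]
    exact key _ _ (h2 i)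

/-- The Sobolev space `H²(Ω)`: all weak derivatives of order at most two are in `L²(Ω)`. -/
def H2 {d : ℕ} (Ω : Opens (Space d)) : Set (L2 Ω) :=
  {u | u ∈ H1 Ω ∧ ∀ i : Fin d, weakPartial i u ∈ H1 Ω}

/-- The operator `A = -Δ` with homogeneous Dirichlet boundary condition; its domain is
`D(A) = H²(Ω) ∩ H¹₀(Ω)`. -/
def opA {d : ℕ} {Ω : Opens (Space d)} (v : L2 Ω) : L2 Ω :=
  -∑ i : Fin d, weakPartial i (weakPartial i v)

/-- The energy form `(∇u, ∇w)` on `H¹(Ω)`. -/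
def energy {d : ℕ} {Ω : Opens (Space d)} (u w : H1 Ω) : ℝ :=
  inner ℝ (grad Ω u) (grad Ω w)

lemma H10_le_H1 {d : ℕ} (Ω : Opens (Space d)) : H10 Ω ≤ H1 Ω := fun _ hu => hu.1

/-! ### Triangulations and the finite element space -/

/-- A (conforming) triangulation of `Ω` into finitely many `d`-simplexes. -/
structure Triangulation {d : ℕ} (Ω : Opens (Space d)) where
  /-- the simplicial complex, whose faces are recorded by their vertex sets -/
  complex : Geometry.SimplicialComplex ℝ (Space d)
  finite_faces : complex.faces.Finite
  space_eq : complex.space = closure (Ω : Set (Space d))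
  pure : ∀ s ∈ complex.faces, ∃ t ∈ complex.faces, s ⊆ t ∧ t.card = d + 1

/-- The vertex sets of the `d`-simplexes of the triangulation. -/
def Triangulation.cells {d : ℕ} {Ω : Opens (Space d)} (𝒯 : Triangulation Ω) :
    Set (Finset (Space d)) :=
  {s | s ∈ 𝒯.complex.faces ∧ s.card = d + 1}

/-- The finite element space `X_h` of all `v_h ∈ H¹₀(Ω)` whose restriction to every simplex of
the triangulation is a linear (that is, affine) function. -/
def Xh {d : ℕ} {Ω : Opens (Space d)} (𝒯 : Triangulation Ω) : Submodule ℝ (L2 Ω) where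
  carrier := {v | v ∈ H10 Ω ∧ ∀ s ∈ 𝒯.cells, ∃ p : Space d →ᵃ[ℝ] ℝ,
    ∀ᵐ x ∂(volume.restrict (Ω : Set (Space d))),
      x ∈ convexHull ℝ (s : Set (Space d)) → v x = p x}
  add_mem' := by
    rintro u v ⟨hu, hu'⟩ ⟨hv, hv'⟩
    refine ⟨(H10 Ω).add_mem hu hv, fun s hs => ?_⟩
    obtain ⟨p, hp⟩ := hu' s hs
    obtain ⟨q, hq⟩ := hv' s hs
    refine ⟨p + q, ?_⟩
    filter_upwards [hp, hq, Lp.coeFn_add u v] with x h1 h2 h3 hx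
    rw [h3, Pi.add_apply, h1 hx, h2 hx]
    rfl
  zero_mem' := by
    refine ⟨(H10 Ω).zero_mem, fun s _ => ⟨0, ?_⟩⟩
    filter_upwards [Lp.coeFn_zero ℝ 2 (volume.restrict (Ω : Set (Space d)))] with x hx _
    rw [hx]
    rfl
  smul_mem' := by
    rintro a u ⟨hu, hu'⟩
    refine ⟨(H10 Ω).smul_mem a hu, fun s hs => ?_⟩
    obtain ⟨p, hp⟩ := hu' s hs
    refine ⟨a • p, ?_⟩
    filter_upwards [hp, Lp.coeFn_smul a u] with x h1 h3 hx
    simp [h3, h1 hx]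

lemma Xh_le_H1 {d : ℕ} {Ω : Opens (Space d)} (𝒯 : Triangulation Ω) : Xh 𝒯 ≤ H1 Ω :=
  fun _ hu => hu.1.1

instance finiteDimensional_Xh {d : ℕ} {Ω : Opens (Space d)} (𝒯 : Triangulation Ω) :
    FiniteDimensional ℝ (Xh 𝒯) := by
  have hfin : Finite 𝒯.cells := (𝒯.finite_faces.subset fun _ hs => hs.1).to_subtype
  let S : Submodule ℝ ((𝒯.cells → (Space d →ᵃ[ℝ] ℝ)) × Xh 𝒯) :=
    { carrier := {z | ∀ s : 𝒯.cells, ∀ᵐ x ∂(volume.restrict (Ω : Set (Space d))),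
        x ∈ convexHull ℝ ((s : Finset (Space d)) : Set (Space d)) → (z.2 : L2 Ω) x = z.1 s x}
      add_mem' := by
        intro z w hz hw s
        filter_upwards [hz s, hw s, Lp.coeFn_add (z.2 : L2 Ω) (w.2 : L2 Ω)] with x h1 h2 h3 hx
        refine h3.trans ?_
        rw [Pi.add_apply, h1 hx, h2 hx]
        rfl
      zero_mem' := by
        intro s
        filter_upwards [Lp.coeFn_zero ℝ 2 (volume.restrict (Ω : Set (Space d)))] with x hx _
        exact hx
      smul_mem' := by
        intro a z hz s
        filter_upwards [hz s, Lp.coeFn_smul a (z.2 : L2 Ω)] with x h1 h3 hx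
        simp [h3, h1 hx] }
  let f : S →ₗ[ℝ] (𝒯.cells → (Space d →ᵃ[ℝ] ℝ)) := LinearMap.fst ℝ _ _ ∘ₗ S.subtype
  let g : S →ₗ[ℝ] Xh 𝒯 := LinearMap.snd ℝ _ _ ∘ₗ S.subtype
  have hf : Function.Injective f := by
    rw [injective_iff_map_eq_zero]
    intro z hz
    have hz1 : z.1.1 = 0 := hz
    have hz2 : ((z.1.2 : Xh 𝒯) : L2 Ω) = 0 := by
      rw [Lp.eq_zero_iff_ae_eq_zero]
      have hall : ∀ᵐ x ∂(volume.restrict (Ω : Set (Space d))), ∀ s : 𝒯.cells,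
          x ∈ convexHull ℝ ((s : Finset (Space d)) : Set (Space d)) →
            (z.1.2 : L2 Ω) x = z.1.1 s x :=
        ae_all_iff.2 z.2
      filter_upwards [hall, ae_restrict_mem Ω.isOpen.measurableSet] with x hx hxΩ
      have hxs : x ∈ 𝒯.complex.space := by
        rw [𝒯.space_eq]
        exact subset_closure hxΩ
      obtain ⟨s, hs, hxs⟩ := Geometry.SimplicialComplex.mem_space_iff.1 hxs
      obtain ⟨t, ht, hst, hcard⟩ := 𝒯.pure s hs
      rw [hx ⟨t, ht, hcard⟩ (convexHull_mono (by exact_mod_cast hst) hxs), hz1]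
      rfl
    exact Subtype.ext (Prod.ext hz1 (Subtype.ext hz2))
  have : FiniteDimensional ℝ S := FiniteDimensional.of_injective f hf
  refine Module.Finite.of_surjective g fun v => ?_
  choose p hp using v.2.2
  exact ⟨⟨(fun s => p s.1 s.2, v), fun s => hp s.1 s.2⟩, rfl⟩

/-- An element of `X_h` seen in `H¹(Ω)`. -/
def toH1 {d : ℕ} {Ω : Opens (Space d)} (𝒯 : Triangulation Ω) : Xh 𝒯 →ₗ[ℝ] H1 Ω :=
  Submodule.inclusion (Xh_le_H1 𝒯)

/-- The `L²(Ω)`-orthogonal projection `P_h : L²(Ω) → X_h`. -/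
def Ph {d : ℕ} {Ω : Opens (Space d)} (𝒯 : Triangulation Ω) : L2 Ω →L[ℝ] Xh 𝒯 :=
  (Xh 𝒯).orthogonalProjectionOnto

lemma exists_ritz {d : ℕ} {Ω : Opens (Space d)} (𝒯 : Triangulation Ω) (φ : H10 Ω) :
    ∃ w : Xh 𝒯, ∀ χ : Xh 𝒯, energy (toH1 𝒯 w) (toH1 𝒯 χ) =
      energy (Submodule.inclusion (H10_le_H1 Ω) φ) (toH1 𝒯 χ) := by
  let G := LinearMap.range (grad Ω ∘ₗ toH1 𝒯)
  obtain ⟨w, hw⟩ := (G.orthogonalProjectionOnto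
    (grad Ω (Submodule.inclusion (H10_le_H1 Ω) φ))).2
  refine ⟨w, fun χ => ?_⟩
  have h := Submodule.starProjection_inner_eq_zero (K := G)
    (grad Ω (Submodule.inclusion (H10_le_H1 Ω) φ)) (grad Ω (toH1 𝒯 χ)) ⟨χ, rfl⟩
  rw [inner_sub_left, sub_eq_zero] at h
  rw [energy, energy, h]
  congr 1

/-- The Ritz projection `R_h : H¹₀(Ω) → X_h`, determined by
`(∇ R_h φ, ∇ χ) = (∇ φ, ∇ χ)` for all `χ ∈ X_h`. -/
def Rh {d : ℕ} {Ω : Opens (Space d)} (𝒯 : Triangulation Ω) (φ : H10 Ω) : Xh 𝒯 :=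
  (exists_ritz 𝒯 φ).choose

lemma Rh_spec {d : ℕ} {Ω : Opens (Space d)} (𝒯 : Triangulation Ω) (φ : H10 Ω) (χ : Xh 𝒯) :
    energy (toH1 𝒯 (Rh 𝒯 φ)) (toH1 𝒯 χ) =
      energy (Submodule.inclusion (H10_le_H1 Ω) φ) (toH1 𝒯 χ) :=
  (exists_ritz 𝒯 φ).choose_spec χ

/-- The gradient on the finite-dimensional space `X_h`. -/
def gradh {d : ℕ} {Ω : Opens (Space d)} (𝒯 : Triangulation Ω) :
    Xh 𝒯 →L[ℝ] PiLp 2 (fun _ : Fin d => L2 Ω) :=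
  LinearMap.toContinuousLinearMap (grad Ω ∘ₗ toH1 𝒯)

/-- The operator `A_h = -Δ_h : X_h → X_h`, where `Δ_h` is the discrete Laplacian, i.e.
`(A_h φ, χ) = (∇ φ, ∇ χ)` for all `φ, χ ∈ X_h` (see `Ah_spec`). -/
def Ah {d : ℕ} {Ω : Opens (Space d)} (𝒯 : Triangulation Ω) : Xh 𝒯 →L[ℝ] Xh 𝒯 :=
  ContinuousLinearMap.adjoint (gradh 𝒯) ∘L gradh 𝒯

lemma Ah_spec {d : ℕ} {Ω : Opens (Space d)} (𝒯 : Triangulation Ω) (φ χ : Xh 𝒯) :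
    inner ℝ (Ah 𝒯 φ) χ = energy (toH1 𝒯 φ) (toH1 𝒯 χ) := by
  rw [Ah, ContinuousLinearMap.comp_apply, ContinuousLinearMap.adjoint_inner_left]
  rfl

/-! ### The semidiscrete and the fully discrete scheme -/

/-- The Caputo derivative
`∂_t^α u(t) = Γ(1-α)⁻¹ ∫₀ᵗ (t-s)^{-α} u'(s) ds` of order `α ∈ (0,1)`. -/
def caputo {X : Type*} [NormedAddCommGroup X] [NormedSpace ℝ X] (α : ℝ) (u : ℝ → X) (t : ℝ) : X :=
  (Real.Gamma (1 - α))⁻¹ • ∫ s in (0 : ℝ)..t, (t - s) ^ (-α) • deriv u s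

/-- `u : [0,T] → X_h` solves the semidiscrete Galerkin scheme
`∂_t^α u_h(t) + A_h u_h(t) = P_h f(t)` for `0 < t ≤ T`, `u_h(0) = v_h`.
The solution is continuous on `[0,T]`, differentiable on `(0,T)`, and the integrals defining its
Caputo derivative converge; values of `u` outside `[0,T]` play no role. -/
structure IsSemidiscreteSolution {d : ℕ} {Ω : Opens (Space d)} (𝒯 : Triangulation Ω) (α T : ℝ)
    (f : ℝ → L2 Ω) (vh : Xh 𝒯) (u : ℝ → Xh 𝒯) : Prop where
  continuousOn : ContinuousOn u (Set.Icc 0 T)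
  differentiableAt : ∀ t ∈ Set.Ioo 0 T, DifferentiableAt ℝ u t
  integrable : ∀ t ∈ Set.Ioc 0 T,
    IntervalIntegrable (fun s => (t - s) ^ (-α) • deriv u s) volume 0 t
  equation : ∀ t ∈ Set.Ioc 0 T, caputo α u t + Ah 𝒯 (u t) = Ph 𝒯 (f t)
  initial : u 0 = vh

/-- The weights `b_j = ((j+1)^{1-α} - j^{1-α}) / Γ(2-α)` of the L1 scheme. -/
def weight (α : ℝ) (j : ℕ) : ℝ :=
  (((j : ℝ) + 1) ^ (1 - α) - (j : ℝ) ^ (1 - α)) / Real.Gamma (2 - α)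

/-- `U⁰, …, U^N ∈ X_h` is the solution of the fully discrete L1 scheme with step size `τ`
and initial value `v_h`: for `n = 1, …, N`,
`(b₀ I + τ^α A_h) Uⁿ = b_{n-1} U⁰ + ∑_{j=1}^{n-1} (b_{j-1} - b_j) U^{n-j} + τ^α P_h f(t_n)`. -/
structure IsFullyDiscreteSolution {d : ℕ} {Ω : Opens (Space d)} (𝒯 : Triangulation Ω)
    (α τ : ℝ) (N : ℕ) (f : ℝ → L2 Ω) (vh : Xh 𝒯) (U : ℕ → Xh 𝒯) : Prop where
  initial : U 0 = vh
  equation : ∀ n : ℕ, 1 ≤ n → n ≤ N →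
    weight α 0 • U n + τ ^ α • Ah 𝒯 (U n) =
      weight α (n - 1) • U 0 +
        ∑ j ∈ Finset.Icc 1 (n - 1), (weight α (j - 1) - weight α j) • U (n - j) +
        τ ^ α • Ph 𝒯 (f (n * τ))

end Subdiffusion

end

open Subdiffusion

/-!
The operator `A_h` is symmetric and positive semidefinite on the finite-dimensional space `X_h`, so
the semidiscrete and the fully discrete problem decouple along an eigenbasis into scalar problems
`∂_t^α y + ν y = 0` and the corresponding L1 schemes. As `A_h R_h v` is the `L²`-projection of `A v`
(`norm_Ah_Rh_le`), it suffices to bound the scalar error by `c τ t_n^{α-1} ν |y(0)|` with `c`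
independent of `ν ≥ 0` (`abs_caputo_sub_scheme_le`). Rescaling time reduces this to `τ = 1`, with
`μ = ν τ^α` in place of `ν`.

**The exact solution.** By the maximum principle for the Caputo derivative the scalar problem has no
solution but `y(0) E` with the Mittag-Leffler function `E(t) = E_α(-μ t^α)` (`eq_mlE_of_caputo`).
Let `w = -E'` and `k(t) = t^{-α} / Γ(1-α)`. Convolving power series term by term gives
`k ∗ w = μ E`, `t w = α (w ∗ E)` and `(t w)' = α (w - w ∗ w)`. The first two identities exclude a
first zero of `E` or `w`, so both are positive for `μ > 0` (`mlE_pos_and_mlW_pos`); the third one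
then shows that `w` is nonincreasing (`antitoneOn_mlW`), and the first one that
`w(t) ≤ Γ(2-α) μ t^{α-1}` (`mlW_le`). No bound on `E''` is needed.

**The scheme.** The weights `b_j = ∫_j^{j+1} k` are log-convex, so by Kaluza's theorem
(`coeff_succ_inv_mk_nonpos`) the complementary kernel `P`, given by
`∑_{i ≤ n} P_i b_{n-i} = 1`, is nonincreasing, and thus
`P_n ≤ (b_0 + ⋯ + b_n)⁻¹ = Γ(2-α) (n+1)^{α-1}`. Convolution with `P ≥ 0` inverts the discrete
fractional derivative, and the error at step `n` is at most `∑_m P_{n-m} |r_m|` with the truncation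
errors `r_m` (`abs_le_of_fracDiff`).

**Combination.** Up to corrections at the two singularities, `|r_m|` is bounded by the convolution
of the increments `k(i) - k(i+1)` with the decrements `w(j-1) - w(j)` (`abs_truncation_le`). Since
`k(i) - k(i+1) ≤ b_{i-1} - b_{i+1}` and `P ∗ b = 1`, convolving the former with `P` telescopes to a
multiple of `P` (`coeff_compKernel_mul_le`). What is left is `∑_j P_{n-j} (w(j-1) - w(j))`. For
`j ≤ n/2` the factor `P_{n-j}` is of order `n^{α-1}` and the decrements add up to at most `c μ`; for
`j > n/2` the factor `P_{n-j}` is bounded and the decrements add up to at most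
`w(n/2) ≤ c μ n^{α-1}` (`coeff_compKernel_mul_mlWVar_le`).
-/

namespace Subdiffusion

/-! ### Riemann–Liouville kernels and termwise convolution -/

/-- The Riemann–Liouville kernel `t^{p-1} / Γ(p)` of order `p`. -/
noncomputable def rlKernel (p t : ℝ) : ℝ := t ^ (p - 1) / Real.Gamma p

lemma rlKernel_pos {p t : ℝ} (hp : 0 < p) (ht : 0 < t) : 0 < rlKernel p t :=
  div_pos (Real.rpow_pos_of_pos ht _) (Real.Gamma_pos_of_pos hp)

lemma rlKernel_one (t : ℝ) : rlKernel 1 t = 1 := by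
  simp [rlKernel]

lemma mul_rlKernel {p t : ℝ} (hp : 0 < p) (ht : 0 < t) :
    t * rlKernel p t = p * rlKernel (p + 1) t := by
  have hG := (Real.Gamma_pos_of_pos hp).ne'
  rw [rlKernel, rlKernel, Real.Gamma_add_one hp.ne', add_sub_cancel_right,
    Real.rpow_sub_one ht.ne']
  field_simp

lemma hasDerivAt_rlKernel_add_one {p t : ℝ} (hp : 0 < p) (ht : 0 < t) :
    HasDerivAt (rlKernel (p + 1)) (rlKernel p t) t := by
  have h := (Real.hasDerivAt_rpow_const (x := t) (p := p) (Or.inl ht.ne')).div_const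
    (Real.Gamma (p + 1))
  have hG := (Real.Gamma_pos_of_pos hp).ne'
  convert! h using 1
  · ext s
    simp [rlKernel]
  · rw [rlKernel, Real.Gamma_add_one hp.ne']
    field_simp

/-- The kernels form a convolution semigroup, by Euler's beta integral. -/
lemma integral_rlKernel_mul {p q t : ℝ} (hp : 0 < p) (hq : 0 < q) (ht : 0 < t) :
    ∫ s in (0 : ℝ)..t, rlKernel p (t - s) * rlKernel q s = rlKernel (p + q) t := by
  have hGp := (Real.Gamma_pos_of_pos hp).ne'
  have hGq := (Real.Gamma_pos_of_pos hq).ne'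
  have hGpq := (Real.Gamma_pos_of_pos (add_pos hp hq)).ne'
  have key : ∫ s in (0 : ℝ)..t, s ^ (q - 1) * (t - s) ^ (p - 1) =
      t ^ (q + p - 1) * (Real.Gamma q * Real.Gamma p / Real.Gamma (q + p)) := by
    have h := Complex.betaIntegral_scaled q p ht
    rw [Complex.betaIntegral_eq_Gamma_mul_div _ _ (by simpa) (by simpa)] at h
    apply Complex.ofReal_injective
    rw [← intervalIntegral.integral_ofReal]
    have e : ∫ s in (0 : ℝ)..t, ((s ^ (q - 1) * (t - s) ^ (p - 1) : ℝ) : ℂ) =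
        ∫ x in (0 : ℝ)..t, (x : ℂ) ^ ((q : ℂ) - 1) * ((t : ℂ) - x) ^ ((p : ℂ) - 1) := by
      refine intervalIntegral.integral_congr fun s hs => ?_
      rw [Set.uIcc_of_le ht.le] at hs
      rw [Complex.ofReal_mul, Complex.ofReal_cpow hs.1, Complex.ofReal_cpow (sub_nonneg.2 hs.2)]
      push_cast
      rfl
    rw [e, h, Complex.ofReal_mul, Complex.ofReal_cpow ht.le, Complex.ofReal_div,
      Complex.ofReal_mul, ← Complex.Gamma_ofReal, ← Complex.Gamma_ofReal, ← Complex.Gamma_ofReal]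
    push_cast
    rfl
  have e : ∀ s, rlKernel p (t - s) * rlKernel q s =
      (s ^ (q - 1) * (t - s) ^ (p - 1)) * (Real.Gamma p * Real.Gamma q)⁻¹ := by
    intro s
    simp only [rlKernel]
    field_simp
  simp_rw [e]
  rw [intervalIntegral.integral_mul_const, key, rlKernel, add_comm q p]
  field_simp

lemma intervalIntegrable_rlKernel_mul {p q t : ℝ} (hp : 0 < p) (hq : 0 < q) (ht : 0 < t) :
    IntervalIntegrable (fun s => rlKernel p (t - s) * rlKernel q s) volume 0 t := by
  -- a function with a nonzero Bochner integral is integrable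
  by_contra h
  have := integral_rlKernel_mul hp hq ht
  rw [intervalIntegral.integral_undef h] at this
  exact (rlKernel_pos (add_pos hp hq) ht).ne this

/-- Termwise integration, including the integrability of the sum. -/
lemma hasSum_integral_and_integrable {X ι : Type*} [MeasurableSpace X] {μ : Measure X}
    [Countable ι] {f : ι → X → ℝ} {F : X → ℝ} (hf : ∀ i, Integrable (f i) μ)
    (hs : Summable fun i => ∫ x, ‖f i x‖ ∂μ) (hF : ∀ᵐ x ∂μ, HasSum (fun i => f i x) (F x)) :
    HasSum (fun i => ∫ x, f i x ∂μ) (∫ x, F x ∂μ) ∧ Integrable F μ := by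
  refine ⟨?_, ?_, ?_⟩
  · have h := hasSum_integral_of_summable_integral_norm hf hs
    rwa [integral_congr_ae (hF.mono fun x hx => hx.tsum_eq)] at h
  · refine aestronglyMeasurable_of_tendsto_ae Filter.atTop
      (f := fun (S : Finset ι) x => ∑ i ∈ S, f i x) (fun S => ?_) hF
    exact Finset.aestronglyMeasurable_fun_sum S fun i _ => (hf i).1
  · have h1 : ∀ᵐ x ∂μ, ‖F x‖ₑ ≤ ∑' i, ‖f i x‖ₑ := by
      filter_upwards [hF] with x hx
      rw [← hx.tsum_eq]
      exact enorm_tsum_le_tsum_enorm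
    refine (lintegral_mono_ae h1).trans_lt ?_
    rw [lintegral_tsum fun i => (hf i).1.enorm]
    have h2 : ∀ i, ∫⁻ x, ‖f i x‖ₑ ∂μ = ENNReal.ofReal (∫ x, ‖f i x‖ ∂μ) := fun i => by
      rw [ofReal_integral_norm_eq_lintegral_enorm (hf i)]
    simp_rw [h2]
    rw [← ENNReal.ofReal_tsum_of_nonneg (fun i => integral_nonneg fun x => norm_nonneg _) hs]
    exact ENNReal.ofReal_lt_top

/-- Two series of kernels may be convolved term by term. -/
lemma hasSum_rlKernel_conv {ι κ : Type*} [Countable ι] [Countable κ] {a p : ι → ℝ} {b q : κ → ℝ}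
    (hp : ∀ i, 0 < p i) (hq : ∀ j, 0 < q j) {t : ℝ} (ht : 0 < t) {F G : ℝ → ℝ}
    (hF : ∀ s, 0 < s → HasSum (fun i => a i * rlKernel (p i) s) (F s))
    (hG : ∀ s, 0 < s → HasSum (fun j => b j * rlKernel (q j) s) (G s))
    (hs : Summable fun x : ι × κ => |a x.1 * b x.2| * rlKernel (p x.1 + q x.2) t) :
    HasSum (fun x : ι × κ => a x.1 * b x.2 * rlKernel (p x.1 + q x.2) t)
      (∫ s in (0 : ℝ)..t, F (t - s) * G s) ∧
    IntervalIntegrable (fun s => F (t - s) * G s) volume 0 t := by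
  have hI : ∀ x : ι × κ, Integrable (fun s => a x.1 * b x.2 *
      (rlKernel (p x.1) (t - s) * rlKernel (q x.2) s)) (volume.restrict (Set.Ioo 0 t)) := by
    intro x
    have h := intervalIntegrable_rlKernel_mul (hp x.1) (hq x.2) ht
    rw [intervalIntegrable_iff_integrableOn_Ioo_of_le ht.le] at h
    exact h.const_mul _
  have hint : ∀ x : ι × κ, ∫ s in Set.Ioo 0 t, rlKernel (p x.1) (t - s) * rlKernel (q x.2) s =
      rlKernel (p x.1 + q x.2) t := by
    intro x
    rw [← integral_rlKernel_mul (hp x.1) (hq x.2) ht, intervalIntegral.integral_of_le ht.le,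
      integral_Ioc_eq_integral_Ioo]
  have hnorm : ∀ x : ι × κ, ∫ s in Set.Ioo 0 t, ‖a x.1 * b x.2 *
      (rlKernel (p x.1) (t - s) * rlKernel (q x.2) s)‖ =
      |a x.1 * b x.2| * rlKernel (p x.1 + q x.2) t := by
    intro x
    rw [← hint x, ← integral_const_mul]
    refine setIntegral_congr_fun measurableSet_Ioo fun s hs => ?_
    have h1 := rlKernel_pos (hp x.1) (sub_pos.2 hs.2)
    have h2 := rlKernel_pos (hq x.2) hs.1
    rw [norm_mul, Real.norm_eq_abs, Real.norm_of_nonneg (mul_pos h1 h2).le]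
  have h := hasSum_integral_and_integrable (F := fun s => F (t - s) * G s) hI
    (by simpa only [hnorm] using hs) (by
      filter_upwards [ae_restrict_mem measurableSet_Ioo] with s hs
      have h1 := hF _ (sub_pos.2 hs.2)
      have h2 := hG _ hs.1
      have h3 := h1.mul h2 (summable_mul_of_summable_norm h1.summable.norm h2.summable.norm)
      refine h3.congr_fun ?_
      intro x
      ring)
  rw [intervalIntegrable_iff_integrableOn_Ioo_of_le ht.le, intervalIntegral.integral_of_le ht.le,
    integral_Ioc_eq_integral_Ioo]
  refine ⟨?_, h.2⟩
  have h1 := h.1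
  simp_rw [integral_const_mul, hint] at h1
  exact h1

/-- A series of kernels may be differentiated term by term. -/
lemma hasDerivAt_rlKernel_series {ι : Type*} {a p : ι → ℝ} (hp : ∀ i, 0 < p i) {F f : ℝ → ℝ}
    (hF : ∀ s, 0 < s → HasSum (fun i => a i * rlKernel (p i + 1) s) (F s))
    (hf : ∀ s, 0 < s → HasSum (fun i => a i * rlKernel (p i) s) (f s)) {t : ℝ} (ht : 0 < t) :
    HasDerivAt F (f t) t := by
  have hbd : Summable fun i => ‖a i * rlKernel (p i) (t / 2)‖ + ‖a i * rlKernel (p i) (2 * t)‖ :=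
    (hf _ (by positivity)).summable.norm.add (hf _ (by positivity)).summable.norm
  have htm : t ∈ Set.Ioo (t / 2) (2 * t) := ⟨by linarith, by linarith⟩
  have h := hasDerivAt_tsum_of_isPreconnected (g := fun i s => a i * rlKernel (p i + 1) s)
    (g' := fun i s => a i * rlKernel (p i) s) hbd isOpen_Ioo isPreconnected_Ioo
    (fun i y hy => (hasDerivAt_rlKernel_add_one (hp i) (by linarith [hy.1])).const_mul (a i))
    (fun i y hy => ?_) htm (hF t ht).summable htm
  · rw [(hf t ht).tsum_eq] at h
    refine h.congr_of_eventuallyEq ?_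
    filter_upwards [lt_mem_nhds ht] with s hs
    exact (hF s hs).tsum_eq.symm
  · have hy0 : 0 < y := by linarith [hy.1]
    have hG := Real.Gamma_pos_of_pos (hp i)
    -- a power function on an interval is at most the larger one of its end values
    have key : rlKernel (p i) y ≤ rlKernel (p i) (t / 2) + rlKernel (p i) (2 * t) := by
      have h1 := rlKernel_pos (hp i) (t := t / 2) (by positivity)
      have h2 := rlKernel_pos (hp i) (t := 2 * t) (by positivity)
      rcases le_total (p i - 1) 0 with h | h
      · have : rlKernel (p i) y ≤ rlKernel (p i) (t / 2) :=
          div_le_div_of_nonneg_right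
            (Real.rpow_le_rpow_of_nonpos (by positivity) hy.1.le h) hG.le
        linarith
      · have : rlKernel (p i) y ≤ rlKernel (p i) (2 * t) :=
          div_le_div_of_nonneg_right (Real.rpow_le_rpow hy0.le hy.2.le h) hG.le
        linarith
    simp only [norm_mul]
    rw [Real.norm_of_nonneg (rlKernel_pos (hp i) hy0).le,
      Real.norm_of_nonneg (rlKernel_pos (hp i) (t := t / 2) (by positivity)).le,
      Real.norm_of_nonneg (rlKernel_pos (hp i) (t := 2 * t) (by positivity)).le, ← mul_add]
    exact mul_le_mul_of_nonneg_left key (norm_nonneg _)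

/-! ### The Mittag-Leffler function -/

/-- The Gamma function beats every exponential. -/
lemma inv_Gamma_le {M y : ℝ} (hM : 0 < M) (hy : 0 < y) :
    (Real.Gamma y)⁻¹ ≤ y * (Real.exp (M + 1) * M ^ (-y)) := by
  have h1 : Real.exp (-(M + 1)) * M ^ y ≤ Real.Gamma (y + 1) := by
    rw [Real.Gamma_eq_integral (by positivity)]
    have hint := Real.GammaIntegral_convergent (s := y + 1) (by positivity)
    calc Real.exp (-(M + 1)) * M ^ y
        = ∫ _ in Set.Ioc M (M + 1), Real.exp (-(M + 1)) * M ^ y := by simp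
      _ ≤ ∫ x in Set.Ioc M (M + 1), Real.exp (-x) * x ^ (y + 1 - 1) := by
          refine setIntegral_mono_on (integrableOn_const (by simp)) (hint.mono_set ?_)
            measurableSet_Ioc ?_
          · intro x hx
            exact hM.trans hx.1
          · intro x hx
            rw [add_sub_cancel_right]
            have := hx.1
            have := hx.2
            gcongr
      _ ≤ _ := by
          refine setIntegral_mono_set hint ?_ ?_
          · filter_upwards [ae_restrict_mem measurableSet_Ioi] with x hx
            have : (0 : ℝ) < x := hx
            simp only [Pi.zero_apply]
            positivity
          · refine Filter.Eventually.of_forall ?_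
            intro x hx
            exact hM.trans hx.1
  have hG := Real.Gamma_pos_of_pos hy
  rw [Real.Gamma_add_one hy.ne'] at h1
  rw [inv_le_iff_one_le_mul₀ hG]
  have h2 : Real.exp (M + 1) * M ^ (-y) * (Real.exp (-(M + 1)) * M ^ y) = 1 := by
    rw [Real.rpow_neg hM.le, Real.exp_neg]
    have := (Real.rpow_pos_of_pos hM y).ne'
    have := (Real.exp_pos (M + 1)).ne'
    field_simp
  have h3 : 0 < Real.exp (M + 1) * M ^ (-y) := by positivity
  calc (1 : ℝ) = Real.exp (M + 1) * M ^ (-y) * (Real.exp (-(M + 1)) * M ^ y) := h2.symm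
    _ ≤ Real.exp (M + 1) * M ^ (-y) * (y * Real.Gamma y) := by gcongr
    _ = _ := by ring

lemma summable_mul_rlKernel {α β t : ℝ} (hα : 0 < α) (hβ : 0 < β) (ht : 0 < t) (μ : ℝ) :
    Summable fun k : ℕ => ((k : ℝ) + 1) * (|μ| ^ k * rlKernel (α * k + β) t) := by
  -- `M` is chosen so that the terms are dominated by `k² 2^{-k}`
  set z : ℝ := 2 * (|μ| * t ^ α + 1) with hz
  have hz0 : 0 < z := by positivity
  set M : ℝ := z ^ α⁻¹ with hM
  have hM0 : 0 < M := by positivity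
  have hMα : M ^ α = z := by
    rw [hM, ← Real.rpow_mul hz0.le, inv_mul_cancel₀ hα.ne', Real.rpow_one]
  have hsum : Summable fun k : ℕ => (α + β) * Real.exp (M + 1) * M ^ (-β) * t ^ (β - 1) *
      ((k : ℝ) ^ 2 * (1 / 2 : ℝ) ^ k + 2 * ((k : ℝ) ^ 1 * (1 / 2 : ℝ) ^ k) + (1 / 2 : ℝ) ^ k) := by
    have hhalf : ‖(1 / 2 : ℝ)‖ < 1 := by norm_num
    have s2 := summable_pow_mul_geometric_of_norm_lt_one (R := ℝ) 2 hhalf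
    have s1 := summable_pow_mul_geometric_of_norm_lt_one (R := ℝ) 1 hhalf
    have s0 := summable_geometric_of_norm_lt_one hhalf
    exact ((s2.add (s1.mul_left 2)).add s0).mul_left _
  refine hsum.of_nonneg_of_le (fun k => ?_) fun k => ?_
  · have := rlKernel_pos (p := α * k + β) (by positivity) ht
    positivity
  · have hy : 0 < α * k + β := by positivity
    have h1 := inv_Gamma_le hM0 hy
    have e1 : M ^ (-(α * k + β)) = M ^ (-β) * (z ^ k)⁻¹ := by
      rw [neg_add_rev, Real.rpow_add hM0, Real.rpow_neg hM0.le (α * k), Real.rpow_mul hM0.le, hMα,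
        Real.rpow_natCast]
    have e2 : t ^ (α * k + β - 1) = t ^ (β - 1) * (t ^ α) ^ k := by
      rw [add_sub_assoc, add_comm, Real.rpow_add ht, Real.rpow_mul ht.le, Real.rpow_natCast]
    have h4 : |μ| ^ k * (t ^ α) ^ k * (z ^ k)⁻¹ ≤ (1 / 2) ^ k := by
      rw [← mul_pow, ← inv_pow, ← mul_pow]
      refine pow_le_pow_left₀ (by positivity) ?_ k
      rw [← div_eq_mul_inv, div_le_div_iff₀ hz0 (by norm_num)]
      rw [hz]
      nlinarith
    have h5 : α * k + β ≤ (α + β) * (k + 1) := by nlinarith [k.cast_nonneg (α := ℝ)]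
    rw [rlKernel, div_eq_mul_inv]
    calc ((k : ℝ) + 1) * (|μ| ^ k * (t ^ (α * k + β - 1) * (Real.Gamma (α * k + β))⁻¹))
        ≤ ((k : ℝ) + 1) * (|μ| ^ k * (t ^ (α * k + β - 1) *
            ((α * k + β) * (Real.exp (M + 1) * M ^ (-(α * k + β)))))) := by gcongr
      _ = (Real.exp (M + 1) * M ^ (-β) * t ^ (β - 1)) * ((k : ℝ) + 1) * (α * k + β) *
            (|μ| ^ k * (t ^ α) ^ k * (z ^ k)⁻¹) := by
          rw [e1, e2]
          ring
      _ ≤ (Real.exp (M + 1) * M ^ (-β) * t ^ (β - 1)) * ((k : ℝ) + 1) * ((α + β) * (k + 1)) *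
            (1 / 2) ^ k := by gcongr
      _ = _ := by ring

/-- The Mittag-Leffler function `t ↦ E_α(-μ t^α)`, which solves `∂_t^α u + μ u = 0`, `u(0) = 1`. -/
noncomputable def mlE (α μ t : ℝ) : ℝ := ∑' k : ℕ, (-μ) ^ k * rlKernel (α * k + 1) t

/-- The negative derivative `μ t^{α-1} E_{α,α}(-μ t^α)` of `mlE α μ`. -/
noncomputable def mlW (α μ t : ℝ) : ℝ := ∑' k : ℕ, μ * (-μ) ^ k * rlKernel (α * k + α) t

lemma summable_pow_mul_rlKernel {α β t : ℝ} (hα : 0 < α) (hβ : 0 < β) (ht : 0 < t) (μ : ℝ) :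
    Summable fun k : ℕ => |μ| ^ k * rlKernel (α * k + β) t := by
  refine (summable_mul_rlKernel hα hβ ht μ).of_nonneg_of_le (fun k => ?_) fun k => ?_
  · have := rlKernel_pos (p := α * k + β) (by positivity) ht
    positivity
  · have := rlKernel_pos (p := α * k + β) (by positivity) ht
    exact le_mul_of_one_le_left (by positivity) (by simp)

lemma hasSum_mlE {α t : ℝ} (hα : 0 < α) (ht : 0 < t) (μ : ℝ) :
    HasSum (fun k : ℕ => (-μ) ^ k * rlKernel (α * k + 1) t) (mlE α μ t) := by
  refine Summable.hasSum (Summable.of_norm ?_)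
  refine (summable_pow_mul_rlKernel hα one_pos ht μ).congr fun k => ?_
  have := rlKernel_pos (p := α * k + 1) (by positivity) ht
  rw [norm_mul, norm_pow, norm_neg, Real.norm_eq_abs, Real.norm_of_nonneg this.le]

lemma hasSum_mlW {α t : ℝ} (hα : 0 < α) (ht : 0 < t) (μ : ℝ) :
    HasSum (fun k : ℕ => μ * (-μ) ^ k * rlKernel (α * k + α) t) (mlW α μ t) := by
  refine Summable.hasSum (Summable.of_norm ?_)
  refine ((summable_pow_mul_rlKernel hα hα ht μ).mul_left |μ|).congr fun k => ?_
  have := rlKernel_pos (p := α * k + α) (by positivity) ht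
  rw [norm_mul, norm_mul, norm_pow, norm_neg, Real.norm_eq_abs, Real.norm_of_nonneg this.le,
    mul_assoc]

lemma mlE_zero {α : ℝ} (hα : 0 < α) (μ : ℝ) : mlE α μ 0 = 1 := by
  rw [mlE, tsum_eq_single 0]
  · simp [rlKernel]
  · intro k hk
    have : α * k ≠ 0 := by positivity
    simp [rlKernel, Real.zero_rpow this]

lemma hasSum_mlE_sub_one {α t : ℝ} (hα : 0 < α) (ht : 0 < t) (μ : ℝ) :
    HasSum (fun k : ℕ => (-μ) ^ (k + 1) * rlKernel (α * k + α + 1) t) (mlE α μ t - 1) := by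
  have h := (hasSum_nat_add_iff' 1).2 (hasSum_mlE hα ht μ)
  simp only [Finset.range_one, Finset.sum_singleton, pow_zero, Nat.cast_zero, mul_zero, zero_add,
    rlKernel_one, mul_one] at h
  refine h.congr_fun fun k => ?_
  push_cast
  rw [mul_add, mul_one]

lemma hasDerivAt_mlE {α t : ℝ} (hα : 0 < α) (ht : 0 < t) (μ : ℝ) :
    HasDerivAt (mlE α μ) (-mlW α μ t) t := by
  have h := hasDerivAt_rlKernel_series (a := fun k : ℕ => (-μ) ^ (k + 1))
    (p := fun k : ℕ => α * k + α) (F := fun s => mlE α μ s - 1) (f := fun s => -mlW α μ s)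
    (fun k => by positivity) (fun s hs => hasSum_mlE_sub_one hα hs μ)
    (fun s hs => (hasSum_mlW hα hs μ).neg.congr_fun fun k => by ring) ht
  simpa using h.add_const 1

/-- Convolution of a single kernel with `mlW`. -/
lemma hasSum_rlKernel_conv_mlW {α p t : ℝ} (hα : 0 < α) (hp : 0 < p) (ht : 0 < t) (μ : ℝ) :
    HasSum (fun k : ℕ => μ * (-μ) ^ k * rlKernel (α * k + (p + α)) t)
      (∫ s in (0 : ℝ)..t, rlKernel p (t - s) * mlW α μ s) ∧
    IntervalIntegrable (fun s => rlKernel p (t - s) * mlW α μ s) volume 0 t := by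
  have h := hasSum_rlKernel_conv (a := fun _ : Unit => 1) (p := fun _ => p)
    (b := fun k : ℕ => μ * (-μ) ^ k) (q := fun k : ℕ => α * k + α) (F := rlKernel p)
    (G := mlW α μ) (fun _ => hp) (fun k => by positivity) ht
    (fun s _ => by simp)
    (fun s hs => hasSum_mlW hα hs μ) (by
      rw [← (Equiv.punitProd ℕ).symm.summable_iff]
      refine ((summable_pow_mul_rlKernel (β := p + α) hα (by positivity) ht μ).mul_left
        |μ|).congr fun k => ?_
      simp only [Function.comp, Equiv.punitProd_symm_apply, one_mul, abs_mul, abs_pow, abs_neg]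
      rw [mul_assoc]
      congr 3
      ring)
  refine ⟨?_, h.2⟩
  have h1 := (Equiv.punitProd ℕ).symm.hasSum_iff.2 h.1
  refine h1.congr_fun fun k => ?_
  simp only [Function.comp, Equiv.punitProd_symm_apply, one_mul]
  congr 2
  ring

/-- The fractional differential equation satisfied by the Mittag-Leffler function. -/
lemma integral_rlKernel_mul_mlW {α t : ℝ} (hα : 0 < α) (hα₁ : α < 1) (ht : 0 < t) (μ : ℝ) :
    ∫ s in (0 : ℝ)..t, rlKernel (1 - α) (t - s) * mlW α μ s = μ * mlE α μ t := by
  refine (hasSum_rlKernel_conv_mlW hα (sub_pos.2 hα₁) ht μ).1.unique ?_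
  refine ((hasSum_mlE hα ht μ).mul_left μ).congr_fun fun k => ?_
  rw [sub_add_cancel, mul_assoc]

lemma intervalIntegrable_mlW {α t : ℝ} (hα : 0 < α) (ht : 0 < t) (μ : ℝ) :
    IntervalIntegrable (mlW α μ) volume 0 t := by
  simpa [rlKernel_one] using (hasSum_rlKernel_conv_mlW hα one_pos ht μ).2

lemma integral_mlW {α t : ℝ} (hα : 0 < α) (ht : 0 < t) (μ : ℝ) :
    ∫ s in (0 : ℝ)..t, mlW α μ s = 1 - mlE α μ t := by
  have h := (hasSum_rlKernel_conv_mlW hα one_pos ht μ).1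
  simp only [rlKernel_one, one_mul] at h
  refine h.unique ?_
  rw [← neg_sub]
  refine (hasSum_mlE_sub_one hα ht μ).neg.congr_fun fun k => ?_
  rw [add_comm 1 α, ← add_assoc]
  ring

lemma continuousOn_mlE {α : ℝ} (hα : 0 < α) (μ : ℝ) : ContinuousOn (mlE α μ) (Set.Ici 0) := by
  intro t ht
  rcases eq_or_lt_of_le (Set.mem_Ici.1 ht) with rfl | ht
  · have h := intervalIntegral.continuousOn_primitive_interval (a := (0 : ℝ)) (b := 1)
      (μ := volume) (f := mlW α μ) ((intervalIntegrable_iff_integrableOn_Icc_of_le zero_le_one).1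
        (intervalIntegrable_mlW hα one_pos μ) |>.mono_set (by rw [Set.uIcc_of_le zero_le_one]))
    have h0 := h 0 (by simp)
    rw [Set.uIcc_of_le zero_le_one] at h0
    have h1 : ContinuousWithinAt (mlE α μ) (Set.Icc 0 1) 0 := by
      refine ((continuousWithinAt_const (b := (1 : ℝ))).sub h0).congr (fun s hs => ?_) ?_
      · rcases eq_or_lt_of_le hs.1 with rfl | hs0
        · simp [mlE_zero hα]
        · change mlE α μ s = 1 - ∫ r in (0 : ℝ)..s, mlW α μ r
          rw [integral_mlW hα hs0, sub_sub_cancel]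
      · simp [mlE_zero hα]
    exact h1.mono_of_mem_nhdsWithin (Icc_mem_nhdsGE zero_lt_one)
  · exact (hasDerivAt_mlE hα ht μ).continuousAt.continuousWithinAt

/-- Summation over the antidiagonals of a double series. -/
lemma hasSum_antidiagonal {c : ℕ → ℝ} (hc : Summable fun n : ℕ => ((n : ℝ) + 1) * |c n|) :
    (Summable fun x : ℕ × ℕ => |c (x.1 + x.2)|) ∧
    ∀ {S : ℝ}, HasSum (fun x : ℕ × ℕ => c (x.1 + x.2)) S →
      HasSum (fun n : ℕ => ((n : ℝ) + 1) * c n) S := by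
  have key : ∀ d : ℕ → ℝ, ∀ n, (∑ x ∈ Finset.HasAntidiagonal.antidiagonal n, d (x.1 + x.2)) =
      ((n : ℝ) + 1) * d n := by
    intro d n
    rw [Finset.sum_congr rfl fun x hx => by rw [Finset.HasAntidiagonal.mem_antidiagonal.1 hx]]
    simp
  refine ⟨?_, fun {S} hS => ?_⟩
  · rw [← Finset.HasAntidiagonal.sigmaAntidiagonalEquivProd.summable_iff,
      summable_sigma_of_nonneg fun x => by exact abs_nonneg _]
    refine ⟨fun n => Summable.of_finite, hc.congr fun n => ?_⟩
    rw [← key fun m => |c m|, tsum_fintype]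
    exact (Finset.sum_coe_sort (Finset.HasAntidiagonal.antidiagonal n)
      fun x : ℕ × ℕ => |c (x.1 + x.2)|).symm
  · have h := Finset.HasAntidiagonal.sigmaAntidiagonalEquivProd.hasSum_iff.2 hS
    refine h.sigma fun n => ?_
    rw [← key c, ← Finset.sum_coe_sort]
    exact hasSum_fintype _

lemma hasSum_mlW_conv_mlE {α t : ℝ} (hα : 0 < α) (ht : 0 < t) (μ : ℝ) :
    HasSum (fun n : ℕ => ((n : ℝ) + 1) * (μ * (-μ) ^ n * rlKernel (α * n + (α + 1)) t))
      (∫ s in (0 : ℝ)..t, mlW α μ (t - s) * mlE α μ s) ∧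
    IntervalIntegrable (fun s => mlW α μ (t - s) * mlE α μ s) volume 0 t := by
  have e : ∀ x : ℕ × ℕ, α * (x.1 : ℝ) + α + (α * x.2 + 1) =
      α * ((x.1 + x.2 : ℕ) : ℝ) + (α + 1) := fun x => by
    push_cast
    ring
  have hanti := hasSum_antidiagonal (c := fun n => μ * (-μ) ^ n * rlKernel (α * n + (α + 1)) t) (by
    refine ((summable_mul_rlKernel (β := α + 1) hα (by positivity) ht μ).mul_left
      |μ|).congr fun k => ?_
    have := rlKernel_pos (p := α * k + (α + 1)) (by positivity) ht
    simp only [abs_mul, abs_pow, abs_neg, abs_of_pos this]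
    ring)
  have h := hasSum_rlKernel_conv (a := fun k : ℕ => μ * (-μ) ^ k)
    (p := fun k : ℕ => α * k + α) (b := fun k : ℕ => (-μ) ^ k) (q := fun k : ℕ => α * k + 1)
    (F := mlW α μ) (G := mlE α μ) (fun k => by positivity) (fun k => by positivity) ht
    (fun s hs => hasSum_mlW hα hs μ) (fun s hs => hasSum_mlE hα hs μ) (by
      refine hanti.1.congr fun x => ?_
      have := rlKernel_pos (p := α * ((x.1 + x.2 : ℕ) : ℝ) + (α + 1)) (by positivity) ht
      rw [e x, abs_mul _ (rlKernel _ _), abs_of_pos this, pow_add, mul_assoc])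
  refine ⟨hanti.2 (h.1.congr_fun fun x => ?_), h.2⟩
  rw [e x, pow_add]
  ring

lemma hasSum_mlW_conv_mlW {α t : ℝ} (hα : 0 < α) (ht : 0 < t) (μ : ℝ) :
    HasSum (fun n : ℕ => ((n : ℝ) + 1) * (μ * (μ * (-μ) ^ n) * rlKernel (α * n + (α + α)) t))
      (∫ s in (0 : ℝ)..t, mlW α μ (t - s) * mlW α μ s) := by
  have e : ∀ x : ℕ × ℕ, α * (x.1 : ℝ) + α + (α * x.2 + α) =
      α * ((x.1 + x.2 : ℕ) : ℝ) + (α + α) := fun x => by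
    push_cast
    ring
  have hanti := hasSum_antidiagonal
    (c := fun n => μ * (μ * (-μ) ^ n) * rlKernel (α * n + (α + α)) t) (by
    refine ((summable_mul_rlKernel (β := α + α) hα (by positivity) ht μ).mul_left
      (|μ| * |μ|)).congr fun k => ?_
    have := rlKernel_pos (p := α * k + (α + α)) (by positivity) ht
    simp only [abs_mul, abs_pow, abs_neg, abs_of_pos this]
    ring)
  have h := hasSum_rlKernel_conv (a := fun k : ℕ => μ * (-μ) ^ k)
    (p := fun k : ℕ => α * k + α) (b := fun k : ℕ => μ * (-μ) ^ k) (q := fun k : ℕ => α * k + α)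
    (F := mlW α μ) (G := mlW α μ) (fun k => by positivity) (fun k => by positivity) ht
    (fun s hs => hasSum_mlW hα hs μ) (fun s hs => hasSum_mlW hα hs μ) (by
      refine hanti.1.congr fun x => ?_
      have := rlKernel_pos (p := α * ((x.1 + x.2 : ℕ) : ℝ) + (α + α)) (by positivity) ht
      rw [e x, abs_mul _ (rlKernel _ _), abs_of_pos this, pow_add]
      congr 2
      ring)
  refine hanti.2 (h.1.congr_fun fun x => ?_)
  rw [e x, pow_add]
  ring

lemma hasSum_mul_mlW {α t : ℝ} (hα : 0 < α) (ht : 0 < t) (μ : ℝ) :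
    HasSum (fun n : ℕ => α * (((n : ℝ) + 1) * (μ * (-μ) ^ n)) * rlKernel (α * n + α + 1) t)
      (t * mlW α μ t) := by
  refine ((hasSum_mlW hα ht μ).mul_left t).congr_fun fun n => ?_
  have h := mul_rlKernel (p := α * n + α) (by positivity) ht
  calc _ = μ * (-μ) ^ n * ((α * n + α) * rlKernel (α * n + α + 1) t) := by ring
    _ = _ := by rw [← h]; ring

/-- The identity `t w = α (w ∗ E)` behind the positivity of `w = -E'`. -/
lemma mul_mlW_eq_conv {α t : ℝ} (hα : 0 < α) (ht : 0 < t) (μ : ℝ) :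
    t * mlW α μ t = α * ∫ s in (0 : ℝ)..t, mlW α μ (t - s) * mlE α μ s := by
  refine (hasSum_mul_mlW hα ht μ).unique ?_
  refine ((hasSum_mlW_conv_mlE hα ht μ).1.mul_left α).congr_fun fun n => ?_
  rw [add_assoc]
  ring

/-- The identity `(t w)' = α (w - w ∗ w)` behind the monotonicity of `w = -E'`. -/
lemma hasDerivAt_mul_mlW {α t : ℝ} (hα : 0 < α) (ht : 0 < t) (μ : ℝ) :
    HasDerivAt (fun s => s * mlW α μ s)
      (α * (mlW α μ t - ∫ s in (0 : ℝ)..t, mlW α μ (t - s) * mlW α μ s)) t := by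
  refine hasDerivAt_rlKernel_series (a := fun n : ℕ => α * (((n : ℝ) + 1) * (μ * (-μ) ^ n)))
    (p := fun n : ℕ => α * n + α)
    (f := fun t => α * (mlW α μ t - ∫ s in (0 : ℝ)..t, mlW α μ (t - s) * mlW α μ s))
    (fun n => by positivity) (fun s hs => hasSum_mul_mlW hα hs μ) (fun s hs => ?_) ht
  have h1 : HasSum (fun n : ℕ => (n : ℝ) * (μ * (-μ) ^ n * rlKernel (α * n + α) s))
      (-∫ r in (0 : ℝ)..s, mlW α μ (s - r) * mlW α μ r) := by
    rw [← hasSum_nat_add_iff' 1]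
    simp only [Finset.range_one, Finset.sum_singleton, Nat.cast_zero, zero_mul, sub_zero]
    refine (hasSum_mlW_conv_mlW hα hs μ).neg.congr_fun fun n => ?_
    have e : α * (n : ℝ) + (α + α) = α * ((n + 1 : ℕ) : ℝ) + α := by
      push_cast
      ring
    rw [e]
    push_cast
    ring
  have h2 := ((hasSum_mlW hα hs μ).add h1).mul_left α
  rw [← sub_eq_add_neg] at h2
  exact h2.congr_fun fun n => by ring

/-! ### Positivity and monotonicity of the Mittag-Leffler function -/

lemma continuousOn_mlW {α : ℝ} (hα : 0 < α) (μ : ℝ) : ContinuousOn (mlW α μ) (Set.Ioi 0) := by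
  intro t ht
  have h1 : ContinuousAt (fun s => s * mlW α μ s / s) t :=
    (hasDerivAt_mul_mlW hα ht μ).continuousAt.div continuousAt_id (ne_of_gt ht)
  refine (h1.congr ?_).continuousWithinAt
  filter_upwards [lt_mem_nhds ht] with s hs
  exact mul_div_cancel_left₀ _ (ne_of_gt hs)

/-- Near `0` the first term `μ t^{α-1} / Γ(α)` of the series dominates the others. -/
lemma exists_mlW_pos_near_zero {α μ : ℝ} (hα : 0 < α) (hμ : 0 < μ) :
    ∃ ε > 0, ∀ t, 0 < t → t < ε → 0 < mlW α μ t := by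
  have hS : Summable fun k : ℕ => μ * (μ ^ (k + 1) * rlKernel (α * ((k + 1 : ℕ) : ℝ) + α) 1) := by
    have h := (summable_nat_add_iff 1).2 (summable_pow_mul_rlKernel hα hα one_pos μ)
    rw [abs_of_pos hμ] at h
    exact h.mul_left μ
  set S := ∑' k : ℕ, μ * (μ ^ (k + 1) * rlKernel (α * ((k + 1 : ℕ) : ℝ) + α) 1) with hSdef
  have hG := Real.Gamma_pos_of_pos hα
  have hlim : Filter.Tendsto (fun t : ℝ => t ^ α * S) (nhds 0) (nhds 0) := by
    have h := (Real.continuousAt_rpow_const 0 α (Or.inr hα.le)).tendsto.mul_const S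
    rwa [Real.zero_rpow hα.ne', zero_mul] at h
  obtain ⟨ε, hε, hεt⟩ := Metric.eventually_nhds_iff.1
    (hlim.eventually_lt_const (div_pos hμ hG))
  refine ⟨min ε 1, lt_min hε one_pos, fun t ht htε => ?_⟩
  have h1 : t ^ α * S < μ / Real.Gamma α := by
    refine hεt ?_
    rw [Real.dist_eq, sub_zero, abs_of_pos ht]
    exact htε.trans_le (min_le_left _ _)
  have ht1 : t ≤ 1 := htε.le.trans (min_le_right _ _)
  have h2 := (hasSum_nat_add_iff' 1).2 (hasSum_mlW hα ht μ)
  simp only [Finset.range_one, Finset.sum_singleton, pow_zero, Nat.cast_zero, mul_zero, zero_add,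
    mul_one] at h2
  have h3 : ‖mlW α μ t - μ * rlKernel α t‖ ≤ t ^ (α + α - 1) * S := by
    refine h2.norm_le_of_bounded (hS.hasSum.mul_left _) fun k => ?_
    have hp := rlKernel_pos (p := α * ((k + 1 : ℕ) : ℝ) + α) (by positivity) ht
    rw [norm_mul, norm_mul, norm_pow, norm_neg, Real.norm_of_nonneg hμ.le,
      Real.norm_of_nonneg hp.le]
    have h4 : rlKernel (α * ((k + 1 : ℕ) : ℝ) + α) t ≤
        t ^ (α + α - 1) * rlKernel (α * ((k + 1 : ℕ) : ℝ) + α) 1 := by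
      rw [rlKernel, rlKernel, Real.one_rpow, ← mul_div_assoc, mul_one]
      refine div_le_div_of_nonneg_right ?_ (Real.Gamma_pos_of_pos (by positivity)).le
      refine Real.rpow_le_rpow_of_exponent_ge ht ht1 ?_
      push_cast
      nlinarith [k.cast_nonneg (α := ℝ)]
    calc μ * μ ^ (k + 1) * rlKernel (α * ((k + 1 : ℕ) : ℝ) + α) t
        ≤ μ * μ ^ (k + 1) * (t ^ (α + α - 1) * rlKernel (α * ((k + 1 : ℕ) : ℝ) + α) 1) := by
          gcongr
      _ = _ := by ring
  have h5 : t ^ (α + α - 1) * S < μ * rlKernel α t := by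
    have hta : 0 < t ^ (α - 1) := Real.rpow_pos_of_pos ht _
    calc t ^ (α + α - 1) * S = t ^ (α - 1) * (t ^ α * S) := by
          rw [add_sub_assoc, Real.rpow_add ht]
          ring
      _ < t ^ (α - 1) * (μ / Real.Gamma α) := by gcongr
      _ = μ * rlKernel α t := by
          rw [rlKernel]
          ring
  have h6 := (abs_le.1 h3).1
  linarith

/-- At a first zero `t₀` of `E` or of `w = -E'`, the identities `μ E = k ∗ w` and
`t w = α (w ∗ E)` would express a positive convolution integral by a nonpositive number. -/
lemma mlE_pos_and_mlW_pos {α μ t : ℝ} (hα : 0 < α) (hα₁ : α < 1) (hμ : 0 < μ) (ht : 0 < t) :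
    0 < mlE α μ t ∧ 0 < mlW α μ t := by
  obtain ⟨ε₁, hε₁, hw⟩ := exists_mlW_pos_near_zero hα hμ
  obtain ⟨ε₂, hε₂, hE⟩ : ∃ ε > 0, ∀ t, 0 < t → t < ε → 0 < mlE α μ t := by
    have h := (continuousOn_mlE hα μ) 0 (by simp)
    have h1 := h.tendsto.eventually_const_lt (u := 0) (by rw [mlE_zero hα]; exact one_pos)
    obtain ⟨ε, hε, h2⟩ := Metric.mem_nhdsWithin_iff.1 h1
    refine ⟨ε, hε, fun t ht htε => h2 ⟨?_, ht.le⟩⟩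
    rw [Metric.mem_ball, Real.dist_eq, sub_zero, abs_of_pos ht]
    exact htε
  set ε := min ε₁ ε₂ with hεdef
  have hε : 0 < ε := lt_min hε₁ hε₂
  set f : ℝ → ℝ := fun s => min (mlE α μ s) (mlW α μ s) with hf
  by_contra hcon
  have hft : f t ≤ 0 := by
    by_contra h
    exact hcon (lt_min_iff.1 (not_le.1 h))
  have hnear : ∀ s, 0 < s → s < ε → 0 < f s := fun s hs hsε =>
    lt_min (hE s hs (hsε.trans_le (min_le_right _ _))) (hw s hs (hsε.trans_le (min_le_left _ _)))
  set Z := Set.Ici ε ∩ f ⁻¹' Set.Iic 0 with hZ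
  have hfc : ContinuousOn f (Set.Ici ε) :=
    ((continuousOn_mlE hα μ).mono fun s hs => (hε.le.trans hs : (0 : ℝ) ≤ s)).inf
      ((continuousOn_mlW hα μ).mono fun s hs => (hε.trans_le hs : (0 : ℝ) < s))
  have hZc : IsClosed Z := hfc.preimage_isClosed_of_isClosed isClosed_Ici isClosed_Iic
  have hZb : BddBelow Z := ⟨ε, fun s hs => hs.1⟩
  have hZn : Z.Nonempty := ⟨t, not_lt.1 fun h => (hnear t ht h).not_ge hft, hft⟩
  have ht₀ := hZc.csInf_mem hZn hZb
  set t₀ := sInf Z with ht₀def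
  have ht₀pos : 0 < t₀ := hε.trans_le ht₀.1
  have hpos : ∀ s ∈ Set.Ioo 0 t₀, 0 < mlE α μ s ∧ 0 < mlW α μ s := by
    intro s hs
    rw [← lt_min_iff]
    by_contra h
    have hs' : s ∈ Z := ⟨not_lt.1 fun h' => h (hnear s hs.1 h'), not_lt.1 h⟩
    exact (csInf_le hZb hs').not_gt hs.2
  have hwt : 0 < mlW α μ t₀ := by
    have h1 := mul_mlW_eq_conv hα ht₀pos μ
    have h2 := intervalIntegral.intervalIntegral_pos_of_pos_on
      (hasSum_mlW_conv_mlE hα ht₀pos μ).2 (fun s hs => mul_pos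
        (hpos (t₀ - s) ⟨by linarith [hs.2], by linarith [hs.1]⟩).2 (hpos s hs).1) ht₀pos
    exact pos_of_mul_pos_right (h1 ▸ mul_pos hα h2) ht₀pos.le
  have hEt : 0 < mlE α μ t₀ := by
    have h1 := integral_rlKernel_mul_mlW hα hα₁ ht₀pos μ
    have h2 := intervalIntegral.intervalIntegral_pos_of_pos_on
      (hasSum_rlKernel_conv_mlW hα (sub_pos.2 hα₁) ht₀pos μ).2 (fun s hs => mul_pos
        (rlKernel_pos (sub_pos.2 hα₁) (by linarith [hs.2])) (hpos s hs).2) ht₀pos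
    exact pos_of_mul_pos_right (h1 ▸ h2) hμ.le
  exact (lt_min hEt hwt).not_ge ht₀.2

lemma mlW_zero_left (α t : ℝ) : mlW α 0 t = 0 := by
  simp [mlW]

lemma mlW_nonneg {α μ t : ℝ} (hα : 0 < α) (hα₁ : α < 1) (hμ : 0 ≤ μ) (ht : 0 < t) :
    0 ≤ mlW α μ t := by
  rcases hμ.eq_or_lt with rfl | hμ
  · rw [mlW_zero_left]
  · exact (mlE_pos_and_mlW_pos hα hα₁ hμ ht).2.le

lemma mlE_le_one {α μ t : ℝ} (hα : 0 < α) (hα₁ : α < 1) (hμ : 0 ≤ μ) (ht : 0 < t) :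
    mlE α μ t ≤ 1 := by
  have h := integral_mlW hα ht μ
  have h1 : 0 ≤ ∫ s in (0 : ℝ)..t, mlW α μ s := by
    rw [intervalIntegral.integral_of_le ht.le]
    exact setIntegral_nonneg measurableSet_Ioc fun s hs => mlW_nonneg hα hα₁ hμ hs.1
  linarith

lemma antitoneOn_mlW {α μ : ℝ} (hα : 0 < α) (hα₁ : α < 1) (hμ : 0 ≤ μ) :
    AntitoneOn (mlW α μ) (Set.Ioi 0) := by
  -- `t w' = (t w)' - w = -(1 - α) w - α (w ∗ w)`
  have hd : ∀ t, 0 < t → ∃ w', HasDerivAt (mlW α μ) w' t ∧ w' ≤ 0 := by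
    intro t ht
    have h1 := (hasDerivAt_mul_mlW hα ht μ).div (hasDerivAt_id t) ht.ne'
    refine ⟨_, h1.congr_of_eventuallyEq ?_, ?_⟩
    · filter_upwards [lt_mem_nhds ht] with s hs
      exact (mul_div_cancel_left₀ _ (ne_of_gt hs)).symm
    · have hc : 0 ≤ ∫ s in (0 : ℝ)..t, mlW α μ (t - s) * mlW α μ s := by
        rw [intervalIntegral.integral_of_le ht.le, integral_Ioc_eq_integral_Ioo]
        exact setIntegral_nonneg measurableSet_Ioo fun s hs => mul_nonneg
          (mlW_nonneg hα hα₁ hμ (sub_pos.2 hs.2)) (mlW_nonneg hα hα₁ hμ hs.1)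
      have hw := mlW_nonneg hα hα₁ hμ ht
      refine div_nonpos_of_nonpos_of_nonneg ?_ (by positivity)
      simp only [id]
      nlinarith [mul_nonneg (mul_nonneg hα.le hc) ht.le,
        mul_nonneg (mul_nonneg (sub_nonneg.2 hα₁.le) hw) ht.le]
  refine antitoneOn_of_deriv_nonpos (convex_Ioi 0) (continuousOn_mlW hα μ) ?_ ?_
  · rw [interior_Ioi]
    intro t ht
    obtain ⟨w', h, -⟩ := hd t ht
    exact h.differentiableAt.differentiableWithinAt
  · rw [interior_Ioi]
    intro t ht
    obtain ⟨w', h, h'⟩ := hd t ht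
    rwa [h.deriv]

/-- As `w` is nonincreasing, `w(t) ∫ k ≤ k ∗ w = μ E ≤ μ`. -/
lemma mlW_le {α μ t : ℝ} (hα : 0 < α) (hα₁ : α < 1) (hμ : 0 ≤ μ) (ht : 0 < t) :
    mlW α μ t ≤ Real.Gamma (2 - α) * μ * t ^ (α - 1) := by
  have hp : 0 < 1 - α := sub_pos.2 hα₁
  have hI := (hasSum_rlKernel_conv_mlW hα hp ht μ).2
  have h1 : rlKernel (2 - α) t * mlW α μ t ≤ μ := by
    have e : rlKernel (2 - α) t = ∫ s in (0 : ℝ)..t, rlKernel (1 - α) (t - s) * rlKernel 1 s := by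
      rw [integral_rlKernel_mul hp one_pos ht]
      congr 1
      ring
    have hI' := intervalIntegrable_rlKernel_mul hp one_pos ht
    calc rlKernel (2 - α) t * mlW α μ t
        = ∫ s in (0 : ℝ)..t, rlKernel (1 - α) (t - s) * rlKernel 1 s * mlW α μ t := by
          rw [intervalIntegral.integral_mul_const, e]
      _ ≤ ∫ s in (0 : ℝ)..t, rlKernel (1 - α) (t - s) * mlW α μ s := by
          refine intervalIntegral.integral_mono_on_of_le_Ioo ht.le (hI'.mul_const _) hI
            fun s hs => ?_
          rw [rlKernel_one, mul_one]
          exact mul_le_mul_of_nonneg_left (antitoneOn_mlW hα hα₁ hμ hs.1 ht hs.2.le)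
            (rlKernel_pos hp (sub_pos.2 hs.2)).le
      _ = μ * mlE α μ t := integral_rlKernel_mul_mlW hα hα₁ ht μ
      _ ≤ μ := mul_le_of_le_one_right hμ (mlE_le_one hα hα₁ hμ ht)
  have hG : 0 < Real.Gamma (2 - α) := Real.Gamma_pos_of_pos (by linarith)
  have ht' : 0 < t ^ (1 - α) := Real.rpow_pos_of_pos ht _
  rw [rlKernel, show 2 - α - 1 = 1 - α by ring, div_mul_eq_mul_div, div_le_iff₀ hG] at h1
  rw [show α - 1 = -(1 - α) by ring, Real.rpow_neg ht.le, ← div_eq_mul_inv, le_div_iff₀ ht']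
  linarith

lemma one_sub_mlE_one_le {α μ : ℝ} (hα : 0 < α) (hα₁ : α < 1) (hμ : 0 ≤ μ) :
    1 - mlE α μ 1 ≤ Real.Gamma (1 - α) * μ := by
  have hp : 0 < 1 - α := sub_pos.2 hα₁
  have hG := Real.Gamma_pos_of_pos hp
  calc 1 - mlE α μ 1 = ∫ s in (0 : ℝ)..1, mlW α μ s := (integral_mlW hα one_pos μ).symm
    _ ≤ ∫ s in (0 : ℝ)..1, Real.Gamma (1 - α) * (rlKernel (1 - α) (1 - s) * mlW α μ s) := by
        refine intervalIntegral.integral_mono_on_of_le_Ioo zero_le_one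
          (intervalIntegrable_mlW hα one_pos μ)
          ((hasSum_rlKernel_conv_mlW hα hp one_pos μ).2.const_mul _) fun s hs => ?_
        have h1 : 1 ≤ (1 - s) ^ (1 - α - 1) :=
          Real.one_le_rpow_of_pos_of_le_one_of_nonpos (sub_pos.2 hs.2) (by linarith [hs.1])
            (by linarith)
        have h2 := mlW_nonneg hα hα₁ hμ hs.1
        rw [rlKernel, ← mul_assoc, mul_div_cancel₀ _ hG.ne']
        exact le_mul_of_one_le_left h2 h1
    _ = Real.Gamma (1 - α) * (μ * mlE α μ 1) := by
        rw [intervalIntegral.integral_const_mul, integral_rlKernel_mul_mlW hα hα₁ one_pos]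
    _ ≤ Real.Gamma (1 - α) * μ := by
        gcongr
        exact mul_le_of_le_one_right hμ (mlE_le_one hα hα₁ hμ one_pos)

/-! ### The maximum principle for the Caputo derivative -/

/-- The Caputo derivative is positive at a positive maximum of a function with initial value `0`.
Integrating by parts on `[0, t - ε]` leaves a boundary term at `t - ε`, which is dominated by
`∫ (t - s)^{-α} |z'(s)| ds` over `[t - ε, t]` and vanishes in the limit. -/
lemma caputo_integral_pos_of_isMax {α t : ℝ} (hα : 0 < α) (ht : 0 < t) {z z' : ℝ → ℝ}
    (hc : ContinuousOn z (Set.Icc 0 t)) (hd : ∀ s ∈ Set.Ioo 0 t, HasDerivAt z (z' s) s)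
    (hi : IntervalIntegrable (fun s => (t - s) ^ (-α) * z' s) volume 0 t) (h0 : z 0 = 0)
    (hmax : ∀ s ∈ Set.Icc 0 t, z s ≤ z t) (hpos : 0 < z t) :
    0 < ∫ s in (0 : ℝ)..t, (t - s) ^ (-α) * z' s := by
  set K : ℝ → ℝ := fun s => (t - s) ^ (-α) * z' s with hK
  have hz' : IntervalIntegrable z' volume 0 t := by
    have hcont : ContinuousOn (fun s : ℝ => (t - s) ^ α) (Set.uIcc 0 t) :=
      (continuousOn_const.sub continuousOn_id).rpow_const fun s _ => Or.inr hα.le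
    refine (hi.continuousOn_mul hcont).congr_ae ?_
    have hne : ∀ᵐ s : ℝ ∂(volume.restrict (Set.uIoc 0 t)), s ≠ t :=
      ae_restrict_of_ae (by simp [ae_iff, measure_singleton])
    filter_upwards [hne, ae_restrict_mem measurableSet_uIoc] with s hs hs'
    rw [Set.uIoc_of_le ht.le] at hs'
    have : 0 < t - s := sub_pos.2 (lt_of_le_of_ne hs'.2 hs)
    rw [← mul_assoc, ← Real.rpow_add this, add_neg_cancel, Real.rpow_zero, one_mul]
  have hKa : IntervalIntegrable (fun s => |K s|) volume 0 t := hi.abs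
  have key : ∀ x ∈ Set.Ioo 0 t, t ^ (-α) * z t ≤ (∫ s in (0 : ℝ)..x, K s) +
      ((∫ s in (0 : ℝ)..t, |K s|) - ∫ s in (0 : ℝ)..x, |K s|) := by
    intro x hx
    have hsub : Set.uIcc 0 x ⊆ Set.uIcc 0 t := by
      rw [Set.uIcc_of_le hx.1.le, Set.uIcc_of_le ht.le]
      exact Set.Icc_subset_Icc_right hx.2.le
    have hsub' : Set.uIcc x t ⊆ Set.uIcc 0 t := by
      rw [Set.uIcc_of_le hx.2.le, Set.uIcc_of_le ht.le]
      exact Set.Icc_subset_Icc_left hx.1.le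
    have hparts := intervalIntegral.integral_mul_deriv_eq_deriv_mul_of_hasDerivAt
      (u := fun s => (t - s) ^ (-α)) (v := fun s => z s - z t)
      (u' := fun s => α * (t - s) ^ (-α - 1)) (v' := z') (a := 0) (b := x)
      (by
        refine (continuousOn_const.sub continuousOn_id).rpow_const fun s hs => Or.inl ?_
        rw [Set.uIcc_of_le hx.1.le] at hs
        exact sub_ne_zero.2 (hs.2.trans_lt hx.2).ne')
      (by
        rw [Set.uIcc_of_le hx.1.le]
        exact (hc.mono (Set.Icc_subset_Icc_right hx.2.le)).sub continuousOn_const)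
      (fun s hs => by
        rw [min_eq_left hx.1.le, max_eq_right hx.1.le] at hs
        have hs' : t - s ≠ 0 := by linarith [hs.2, hx.2]
        have h := ((hasDerivAt_id s).const_sub t).rpow_const (p := -α) (Or.inl hs')
        convert! h using 1
        simp)
      (fun s hs => by
        rw [min_eq_left hx.1.le, max_eq_right hx.1.le] at hs
        exact (hd s ⟨hs.1, hs.2.trans hx.2⟩).sub_const _)
      (by
        refine ContinuousOn.intervalIntegrable ?_
        refine continuousOn_const.mul
          ((continuousOn_const.sub continuousOn_id).rpow_const fun s hs => Or.inl ?_)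
        rw [Set.uIcc_of_le hx.1.le] at hs
        exact sub_ne_zero.2 (hs.2.trans_lt hx.2).ne')
      (hz'.mono_set hsub)
    have hneg : ∫ s in (0 : ℝ)..x, α * (t - s) ^ (-α - 1) * (z s - z t) ≤ 0 := by
      rw [intervalIntegral.integral_of_le hx.1.le]
      refine setIntegral_nonpos measurableSet_Ioc fun s hs => ?_
      have h1 : 0 ≤ t - s := by linarith [hs.2, hx.2]
      have h2 := hmax s ⟨hs.1.le, hs.2.trans hx.2.le⟩
      exact mul_nonpos_of_nonneg_of_nonpos (by positivity) (by linarith)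
    have hFTC : ∫ s in x..t, z' s = z t - z x :=
      intervalIntegral.integral_eq_sub_of_hasDerivAt_of_le hx.2.le
        (hc.mono (Set.Icc_subset_Icc_left hx.1.le)) (fun s hs => hd s ⟨hx.1.trans hs.1, hs.2⟩)
        (hz'.mono_set hsub')
    have hbdry : (t - x) ^ (-α) * (z t - z x) ≤ ∫ s in x..t, |K s| := by
      rw [← hFTC, ← intervalIntegral.integral_const_mul]
      refine intervalIntegral.integral_mono_on_of_le_Ioo hx.2.le
        ((hz'.mono_set hsub').const_mul _) (hKa.mono_set hsub') fun s hs => ?_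
      have h1 : 0 < t - s := sub_pos.2 hs.2
      have h2 : (t - x) ^ (-α) ≤ (t - s) ^ (-α) :=
        Real.rpow_le_rpow_of_nonpos h1 (by linarith [hs.1]) (by linarith)
      have h3 : 0 ≤ (t - x) ^ (-α) := by
        have : 0 ≤ t - x := sub_nonneg.2 hx.2.le
        positivity
      calc (t - x) ^ (-α) * z' s ≤ (t - x) ^ (-α) * |z' s| := by
            gcongr
            exact le_abs_self _
        _ ≤ (t - s) ^ (-α) * |z' s| := by gcongr
        _ = |K s| := by rw [hK, abs_mul, abs_of_nonneg (h3.trans h2)]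
    rw [← intervalIntegral.integral_add_adjacent_intervals (hKa.mono_set hsub)
      (hKa.mono_set hsub')]
    rw [hK]
    simp only at hparts ⊢
    rw [hparts, h0, sub_zero]
    linarith
  have hlim : Filter.Tendsto (fun x => (∫ s in (0 : ℝ)..x, K s) +
      ((∫ s in (0 : ℝ)..t, |K s|) - ∫ s in (0 : ℝ)..x, |K s|)) (nhdsWithin t (Set.Iio t))
      (nhds (∫ s in (0 : ℝ)..t, K s)) := by
    have hcp : ∀ f : ℝ → ℝ, IntervalIntegrable f volume 0 t →
        Filter.Tendsto (fun x => ∫ s in (0 : ℝ)..x, f s) (nhdsWithin t (Set.Iio t))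
          (nhds (∫ s in (0 : ℝ)..t, f s)) := by
      intro f hf
      have h := intervalIntegral.continuousOn_primitive_interval (a := (0 : ℝ)) (b := t)
        (μ := volume) (f := f) (by
          rw [Set.uIcc_of_le ht.le]
          exact (intervalIntegrable_iff_integrableOn_Icc_of_le ht.le).1 hf)
      rw [Set.uIcc_of_le ht.le] at h
      have h1 := (h t ⟨ht.le, le_rfl⟩).tendsto
      refine h1.mono_left ?_
      rw [← nhdsWithin_Ioo_eq_nhdsLT ht]
      exact nhdsWithin_mono _ Set.Ioo_subset_Icc_self
    have h := (hcp K hi).add ((hcp _ hKa).const_sub (∫ s in (0 : ℝ)..t, |K s|))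
    rwa [sub_self, add_zero] at h
  have h1 : t ^ (-α) * z t ≤ ∫ s in (0 : ℝ)..t, K s := by
    refine ge_of_tendsto hlim ?_
    filter_upwards [Ioo_mem_nhdsLT ht] with x hx using key x hx
  exact (mul_pos (Real.rpow_pos_of_pos ht _) hpos).trans_le h1

/-- At a positive maximum the two sides of the equation would have opposite signs. -/
lemma caputo_nonpos {α T ν : ℝ} (hα : 0 < α) (hν : 0 ≤ ν) {z z' : ℝ → ℝ}
    (hc : ContinuousOn z (Set.Icc 0 T)) (hd : ∀ s ∈ Set.Ioo 0 T, HasDerivAt z (z' s) s)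
    (hi : ∀ t ∈ Set.Ioc 0 T, IntervalIntegrable (fun s => (t - s) ^ (-α) * z' s) volume 0 t)
    (h0 : z 0 = 0)
    (he : ∀ t ∈ Set.Ioc 0 T, ∫ s in (0 : ℝ)..t, (t - s) ^ (-α) * z' s = -(ν * z t))
    {t : ℝ} (ht : t ∈ Set.Icc 0 T) : z t ≤ 0 := by
  by_contra hcon
  obtain ⟨t₀, ht₀, hmax⟩ := isCompact_Icc.exists_isMaxOn ⟨t, ht⟩ hc
  have hp : 0 < z t₀ := (not_le.1 hcon).trans_le (hmax ht)
  have ht₀pos : 0 < t₀ := by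
    rcases ht₀.1.eq_or_lt with h | h
    · rw [← h, h0] at hp
      exact (lt_irrefl _ hp).elim
    · exact h
  have h := caputo_integral_pos_of_isMax hα ht₀pos (hc.mono (Set.Icc_subset_Icc_right ht₀.2))
    (fun s hs => hd s ⟨hs.1, hs.2.trans_le ht₀.2⟩) (hi t₀ ⟨ht₀pos, ht₀.2⟩) h0
    (fun s hs => hmax ⟨hs.1, hs.2.trans ht₀.2⟩) hp
  rw [he t₀ ⟨ht₀pos, ht₀.2⟩] at h
  nlinarith [mul_nonneg hν hp.le]

/-- A scalar fractional relaxation equation has no solution but the Mittag-Leffler function. -/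
lemma eq_mlE_of_caputo {α T μ : ℝ} (hα : 0 < α) (hα₁ : α < 1) (hμ : 0 ≤ μ) {y y' : ℝ → ℝ}
    (hc : ContinuousOn y (Set.Icc 0 T)) (hd : ∀ s ∈ Set.Ioo 0 T, HasDerivAt y (y' s) s)
    (hi : ∀ t ∈ Set.Ioc 0 T, IntervalIntegrable (fun s => (t - s) ^ (-α) * y' s) volume 0 t)
    (he : ∀ t ∈ Set.Ioc 0 T, (Real.Gamma (1 - α))⁻¹ *
      (∫ s in (0 : ℝ)..t, (t - s) ^ (-α) * y' s) + μ * y t = 0)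
    {t : ℝ} (ht : t ∈ Set.Icc 0 T) : y t = y 0 * mlE α μ t := by
  have hp : 0 < 1 - α := sub_pos.2 hα₁
  have hG := Real.Gamma_pos_of_pos hp
  have hk : ∀ t s : ℝ, (t - s) ^ (-α) * mlW α μ s =
      Real.Gamma (1 - α) * (rlKernel (1 - α) (t - s) * mlW α μ s) := by
    intro t s
    rw [rlKernel, sub_sub_cancel_left]
    field_simp
  have hi' : ∀ t, 0 < t →
      IntervalIntegrable (fun s => (t - s) ^ (-α) * mlW α μ s) volume 0 t := by
    intro t ht
    simp_rw [hk]
    exact (hasSum_rlKernel_conv_mlW hα hp ht μ).2.const_mul _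
  have hcE : ContinuousOn (mlE α μ) (Set.Icc 0 T) :=
    (continuousOn_mlE hα μ).mono Set.Icc_subset_Ici_self
  have heq : ∀ t ∈ Set.Ioc 0 T, ∫ s in (0 : ℝ)..t, (t - s) ^ (-α) * (y' s + y 0 * mlW α μ s) =
      -(Real.Gamma (1 - α) * μ * (y t - y 0 * mlE α μ t)) := by
    intro t ht
    have h1 := he t ht
    have h2 : ∫ s in (0 : ℝ)..t, (t - s) ^ (-α) * mlW α μ s =
        Real.Gamma (1 - α) * (μ * mlE α μ t) := by
      simp_rw [hk]
      rw [intervalIntegral.integral_const_mul, integral_rlKernel_mul_mlW hα hα₁ ht.1]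
    have h3 : ∀ s, (t - s) ^ (-α) * (y' s + y 0 * mlW α μ s) =
        (t - s) ^ (-α) * y' s + y 0 * ((t - s) ^ (-α) * mlW α μ s) := fun s => by ring
    simp_rw [h3]
    rw [intervalIntegral.integral_add (hi t ht) ((hi' t ht.1).const_mul _),
      intervalIntegral.integral_const_mul, h2]
    have h4 : (∫ s in (0 : ℝ)..t, (t - s) ^ (-α) * y' s) = -(Real.Gamma (1 - α) * (μ * y t)) := by
      field_simp at h1
      linarith
    rw [h4]
    ring
  have hder : ∀ s ∈ Set.Ioo 0 T,
      HasDerivAt (fun s => y s - y 0 * mlE α μ s) (y' s + y 0 * mlW α μ s) s := by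
    intro s hs
    have h := (hd s hs).sub ((hasDerivAt_mlE hα hs.1 μ).const_mul (y 0))
    convert! h using 1
    ring
  have hint : ∀ t ∈ Set.Ioc 0 T, IntervalIntegrable
      (fun s => (t - s) ^ (-α) * (y' s + y 0 * mlW α μ s)) volume 0 t := by
    intro t ht
    refine ((hi t ht).add ((hi' t ht.1).const_mul (y 0))).congr_ae ?_
    refine Filter.Eventually.of_forall fun s => ?_
    simp only
    ring
  have hν : 0 ≤ Real.Gamma (1 - α) * μ := by positivity
  have hle := caputo_nonpos (z := fun s => y s - y 0 * mlE α μ s) hα hν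
    (hc.sub (hcE.const_mul (y 0))) hder hint (by simp [mlE_zero hα]) heq ht
  have hge := caputo_nonpos (z := fun s => -(y s - y 0 * mlE α μ s))
    (z' := fun s => -(y' s + y 0 * mlW α μ s)) hα hν (hc.sub (hcE.const_mul (y 0))).neg
    (fun s hs => (hder s hs).neg)
    (fun t ht => by
      simp only [mul_neg]
      exact (hint t ht).neg)
    (by simp [mlE_zero hα])
    (fun t ht => by
      simp only [mul_neg, intervalIntegral.integral_neg]
      rw [heq t ht]) ht
  linarith

/-- The Mittag-Leffler function depends on `μ t^α` only. -/
lemma mlE_scale {α τ : ℝ} (hτ : 0 < τ) (μ : ℝ) {s : ℝ} (hs : 0 < s) :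
    mlE α μ (s * τ) = mlE α (μ * τ ^ α) s := by
  rw [mlE, mlE]
  refine tsum_congr fun k => ?_
  rw [rlKernel, rlKernel, add_sub_cancel_right, Real.mul_rpow hs.le hτ.le, Real.rpow_mul hτ.le α,
    Real.rpow_natCast, ← neg_mul, mul_pow]
  ring

/-! ### Discrete convolution kernels -/

/-- The generating function of the kernel `P` complementary to `b`: it satisfies
`∑_{i ≤ n} P_i b_{n-i} = 1` for every `n`. -/
noncomputable def compKernel (b : ℕ → ℝ) : PowerSeries ℝ :=
  PowerSeries.mk 1 * (PowerSeries.mk b)⁻¹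

section

open PowerSeries

variable {b : ℕ → ℝ}

lemma coeff_mul_range (f g : PowerSeries ℝ) (n : ℕ) :
    coeff n (f * g) = ∑ k ∈ Finset.range (n + 1), coeff k f * coeff (n - k) g := by
  rw [coeff_mul, Finset.Nat.sum_antidiagonal_eq_sum_range_succ_mk]

lemma inv_mk_mul_mk (h0 : b 0 ≠ 0) : (PowerSeries.mk b)⁻¹ * PowerSeries.mk b = 1 :=
  PowerSeries.inv_mul_cancel _ (by simpa [← coeff_zero_eq_constantCoeff_apply] using h0)

lemma compKernel_mul_mk (h0 : b 0 ≠ 0) : compKernel b * PowerSeries.mk b = PowerSeries.mk 1 := by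
  rw [compKernel, mul_assoc, inv_mk_mul_mk h0, mul_one]

lemma sum_compKernel_mul (h0 : b 0 ≠ 0) (n : ℕ) :
    ∑ k ∈ Finset.range (n + 1), coeff k (compKernel b) * b (n - k) = 1 := by
  have h := congrArg (coeff n) (compKernel_mul_mk h0)
  rw [coeff_mul_range] at h
  simpa using h

lemma coeff_compKernel (n : ℕ) :
    coeff n (compKernel b) = ∑ k ∈ Finset.range (n + 1), coeff k (PowerSeries.mk b)⁻¹ := by
  rw [compKernel, mul_comm, coeff_mul_range]
  simp

/-- The discrete fractional difference of `a`, expressed through the values of `a`. -/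
lemma coeff_fracDiff (a : ℕ → ℝ) (n : ℕ) :
    coeff n (PowerSeries.mk b * ((1 - X) * PowerSeries.mk a)) =
    b 0 * a n - ∑ k ∈ Finset.range n, (b k - b (k + 1)) * a (n - 1 - k) := by
  rw [← mul_assoc, coeff_mul_range, Finset.sum_range_succ']
  have h0 : coeff 0 (PowerSeries.mk b * (1 - X)) = b 0 := by
    rw [mul_sub, mul_one, map_sub, coeff_zero_mul_X, sub_zero, coeff_mk]
  have h1 : ∀ k, coeff (k + 1) (PowerSeries.mk b * (1 - X)) = b (k + 1) - b k := by
    intro k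
    rw [mul_sub, mul_one, map_sub, coeff_succ_mul_X, coeff_mk, coeff_mk]
  simp_rw [h0, h1, coeff_mk]
  rw [sub_eq_add_neg, ← Finset.sum_neg_distrib, add_comm, Nat.sub_zero]
  congr 1
  refine Finset.sum_congr rfl fun k _ => ?_
  rw [Nat.sub_sub, add_comm 1 k]
  ring

/-- The discrete fractional difference of `a`, expressed through the increments of `a`. -/
lemma coeff_fracDiff_eq_sum_increments {a : ℕ → ℝ} (ha : a 0 = 0) (n : ℕ) :
    coeff n (PowerSeries.mk b * ((1 - X) * PowerSeries.mk a)) =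
      ∑ j ∈ Finset.range n, (a (j + 1) - a j) * b (n - (j + 1)) := by
  rw [mul_comm, coeff_mul_range, Finset.sum_range_succ']
  have h0 : coeff 0 ((1 - X) * PowerSeries.mk a) = 0 := by
    rw [sub_mul, one_mul, map_sub, coeff_zero_X_mul, sub_zero, coeff_mk, ha]
  have h1 : ∀ k, coeff (k + 1) ((1 - X) * PowerSeries.mk a) = a (k + 1) - a k := by
    intro k
    rw [sub_mul, one_mul, map_sub, coeff_succ_X_mul, coeff_mk, coeff_mk]
  simp_rw [h0, h1, coeff_mk]
  simp

/-- **Kaluza's theorem**: the reciprocal of a power series with positive log-convex coefficients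
has nonpositive coefficients, except for the constant one. -/
lemma coeff_succ_inv_mk_nonpos (hpos : ∀ n, 0 < b n) (hlog : ∀ n, b (n + 1) ^ 2 ≤ b n * b (n + 2))
    (n : ℕ) : coeff (n + 1) (PowerSeries.mk b)⁻¹ ≤ 0 := by
  have hmono : Monotone fun n => b (n + 1) / b n := by
    refine monotone_nat_of_le_succ fun n => ?_
    rw [div_le_div_iff₀ (hpos _) (hpos _)]
    nlinarith [hlog n]
  have h0 : b 0 ≠ 0 := (hpos 0).ne'
  set c : ℕ → ℝ := fun n => coeff n (PowerSeries.mk b)⁻¹ with hc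
  have hconv : ∀ n, ∑ k ∈ Finset.range (n + 1), c k * b (n - k) = if n = 0 then 1 else 0 := by
    intro n
    have h := congrArg (coeff n) (inv_mk_mul_mk h0)
    rw [coeff_mul_range, coeff_one] at h
    simpa using h
  have hc0 : 0 < c 0 := by
    have h := hconv 0
    simp only [zero_add, Finset.range_one, Finset.sum_singleton, if_true, Nat.sub_zero] at h
    exact pos_of_mul_pos_left (h ▸ one_pos) (hpos 0).le
  change c (n + 1) ≤ 0
  induction n using Nat.strong_induction_on with
  | _ n ih =>
    have h1 := hconv (n + 1)
    rw [Finset.sum_range_succ, if_neg (Nat.succ_ne_zero n), Nat.sub_self] at h1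
    rcases Nat.eq_zero_or_pos n with rfl | hn
    · simp only [zero_add, Finset.range_one, Finset.sum_singleton, Nat.sub_zero] at h1
      have := mul_pos hc0 (hpos 1)
      exact (neg_of_mul_neg_left (by linarith : c 1 * b 0 < 0) (hpos 0).le).le
    · have h2 := hconv n
      rw [if_neg hn.ne'] at h2
      -- eliminate `c 0` from the equations of index `n` and `n + 1`
      have h3 : c (n + 1) * (b 0 * b n) =
          ∑ k ∈ Finset.range (n + 1), c k * (b (n + 1) * b (n - k) - b (n + 1 - k) * b n) := by
        have e : ∀ k, c k * (b (n + 1) * b (n - k) - b (n + 1 - k) * b n) =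
            b (n + 1) * (c k * b (n - k)) - b n * (c k * b (n + 1 - k)) := fun k => by ring
        simp_rw [e]
        rw [Finset.sum_sub_distrib, ← Finset.mul_sum, ← Finset.mul_sum, h2]
        linear_combination b n * h1
      have h4 : c (n + 1) * (b 0 * b n) ≤ 0 := by
        rw [h3, Finset.sum_range_succ', Nat.sub_zero, Nat.sub_zero, sub_self, mul_zero, add_zero]
        refine Finset.sum_nonpos fun k hk => ?_
        have hk' := Finset.mem_range.1 hk
        have e : n + 1 - (k + 1) = n - (k + 1) + 1 := by omega
        have h5 := hmono (show n - (k + 1) ≤ n by omega)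
        simp only at h5
        rw [div_le_div_iff₀ (hpos _) (hpos _)] at h5
        rw [e]
        exact mul_nonpos_of_nonpos_of_nonneg (ih k hk') (by linarith)
      exact nonpos_of_mul_nonpos_left h4 (mul_pos (hpos 0) (hpos n))

lemma antitone_coeff_compKernel (hpos : ∀ n, 0 < b n)
    (hlog : ∀ n, b (n + 1) ^ 2 ≤ b n * b (n + 2)) :
    Antitone fun n => coeff n (compKernel b) := by
  refine antitone_nat_of_succ_le fun n => ?_
  rw [coeff_compKernel, coeff_compKernel, Finset.sum_range_succ _ (n + 1)]
  have := coeff_succ_inv_mk_nonpos hpos hlog n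
  linarith

/-- With `c = 1/b` one has `P_n b_n = ∑_{k ≤ n} c_k b_n ≥ ∑_{k ≤ n} c_k b_{n-k} ≥ 0`, because
`c_k ≤ 0` for `k ≥ 1` and `b` is nonincreasing. -/
lemma coeff_compKernel_nonneg (hpos : ∀ n, 0 < b n) (hanti : Antitone b)
    (hlog : ∀ n, b (n + 1) ^ 2 ≤ b n * b (n + 2)) (n : ℕ) : 0 ≤ coeff n (compKernel b) := by
  have h0 : b 0 ≠ 0 := (hpos 0).ne'
  have h := congrArg (coeff n) (inv_mk_mul_mk h0)
  rw [coeff_mul_range, coeff_one] at h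
  have h1 : (0 : ℝ) ≤ if n = 0 then 1 else 0 := by split_ifs <;> norm_num
  rw [← h] at h1
  refine nonneg_of_mul_nonneg_left (h1.trans ?_) (hpos n)
  rw [coeff_compKernel, Finset.sum_mul]
  refine Finset.sum_le_sum fun k hk => ?_
  rw [coeff_mk]
  rcases k with _ | k
  · simp
  · exact mul_le_mul_of_nonpos_left (hanti (Nat.sub_le _ _)) (coeff_succ_inv_mk_nonpos hpos hlog k)

/-- Monotonicity turns `∑_{k ≤ n} P_{n-k} b_k = 1` into a pointwise bound on `P_n`. -/
lemma coeff_compKernel_mul_sum_le (hpos : ∀ n, 0 < b n)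
    (hlog : ∀ n, b (n + 1) ^ 2 ≤ b n * b (n + 2)) (n : ℕ) :
    coeff n (compKernel b) * ∑ k ∈ Finset.range (n + 1), b k ≤ 1 := by
  rw [← sum_compKernel_mul (hpos 0).ne' n, ← Finset.sum_range_reflect, Finset.mul_sum]
  refine Finset.sum_le_sum fun k hk => ?_
  rw [Nat.add_sub_cancel]
  exact mul_le_mul_of_nonneg_right (antitone_coeff_compKernel hpos hlog
    (Nat.lt_succ_iff.1 (Finset.mem_range.1 hk))) (hpos _).le

/-- Discrete comparison principle: the zeroth order term `μ e` with `μ ≥ 0` only helps, and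
convolution with the complementary kernel inverts the fractional difference. -/
lemma abs_le_of_fracDiff (hpos : ∀ n, 0 < b n) (hanti : Antitone b)
    (hlog : ∀ n, b (n + 1) ^ 2 ≤ b n * b (n + 2)) {e ρ : ℕ → ℝ} {μ : ℝ} (hμ : 0 ≤ μ) {N : ℕ}
    (he0 : e 0 = 0) (hρ0 : 0 ≤ ρ 0)
    (h : ∀ n, 1 ≤ n → n ≤ N →
      |coeff n (PowerSeries.mk b * ((1 - X) * PowerSeries.mk e)) + μ * e n| ≤ ρ n)
    {n : ℕ} (hn : n ≤ N) : |e n| ≤ coeff n (compKernel b * PowerSeries.mk ρ) := by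
  have hD : ∀ m ≤ N,
      coeff m (PowerSeries.mk b * ((1 - X) * PowerSeries.mk fun k => |e k|)) ≤ ρ m := by
    intro m hm
    rw [coeff_fracDiff]
    rcases Nat.eq_zero_or_pos m with rfl | hm0
    · simpa [he0] using hρ0
    · refine le_trans ?_ (h m hm0 hm)
      rw [coeff_fracDiff]
      have h1 : |∑ k ∈ Finset.range m, (b k - b (k + 1)) * e (m - 1 - k)| ≤
          ∑ k ∈ Finset.range m, (b k - b (k + 1)) * |e (m - 1 - k)| := by
        refine (Finset.abs_sum_le_sum_abs _ _).trans_eq (Finset.sum_congr rfl fun k _ => ?_)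
        rw [abs_mul, abs_of_nonneg (sub_nonneg.2 (hanti (Nat.le_succ k)))]
      have h2 : |(b 0 + μ) * e m| = (b 0 + μ) * |e m| := by
        rw [abs_mul, abs_of_nonneg (add_nonneg (hpos 0).le hμ)]
      have h3 := abs_sub_abs_le_abs_sub ((b 0 + μ) * e m)
        (∑ k ∈ Finset.range m, (b k - b (k + 1)) * e (m - 1 - k))
      have h4 : b 0 * e m - ∑ k ∈ Finset.range m, (b k - b (k + 1)) * e (m - 1 - k) + μ * e m =
          (b 0 + μ) * e m - ∑ k ∈ Finset.range m, (b k - b (k + 1)) * e (m - 1 - k) := by ring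
      rw [h4]
      have h5 := mul_nonneg hμ (abs_nonneg (e m))
      linarith
  have hinv : compKernel b * (PowerSeries.mk b * ((1 - X) * PowerSeries.mk fun k => |e k|)) =
      PowerSeries.mk fun k => |e k| := by
    rw [← mul_assoc, compKernel_mul_mk (hpos 0).ne', ← mul_assoc, mk_one_mul_one_sub_eq_one,
      one_mul]
  have h1 := congrArg (coeff n) hinv
  rw [coeff_mk] at h1
  rw [← h1, coeff_mul_range, coeff_mul_range _ (PowerSeries.mk ρ)]
  refine Finset.sum_le_sum fun k _ => ?_
  rw [coeff_mk]
  exact mul_le_mul_of_nonneg_left (hD _ ((Nat.sub_le _ _).trans hn))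
    (coeff_compKernel_nonneg hpos hanti hlog k)

/-- A kernel `κ` dominated by the second-order increments `b_{i-1} - b_{i+1}` is negligible: its
convolution with the complementary kernel `P` is at most a multiple of `P`. -/
lemma coeff_compKernel_mul_le (hpos : ∀ n, 0 < b n) (hanti : Antitone b)
    (hlog : ∀ n, b (n + 1) ^ 2 ≤ b n * b (n + 2)) {κ : ℕ → ℝ} (h0 : κ 0 = 2 * b 0)
    (hκ : ∀ i, κ (i + 1) ≤ b i - b (i + 2)) (n : ℕ) :
    coeff n (compKernel b * PowerSeries.mk κ) ≤ 4 * b 0 * coeff n (compKernel b) := by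
  have hP := coeff_compKernel_nonneg hpos hanti hlog
  have hPn := hP n
  have hb0 := hpos 0
  rw [coeff_mul_range, Finset.sum_range_succ, Nat.sub_self, coeff_mk, h0]
  suffices h : ∑ k ∈ Finset.range n, coeff k (compKernel b) * coeff (n - k) (PowerSeries.mk κ) ≤
      2 * b 0 * coeff n (compKernel b) by linarith
  rcases n with _ | n
  · simp only [Finset.range_zero, Finset.sum_empty]
    positivity
  · have h1 := sum_compKernel_mul hb0.ne' n
    have h2 := sum_compKernel_mul hb0.ne' (n + 2)
    rw [Finset.sum_range_succ, Finset.sum_range_succ] at h2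
    rw [show n + 2 - (n + 1) = 1 by omega, Nat.sub_self] at h2
    have h3 : ∑ k ∈ Finset.range (n + 1),
        coeff k (compKernel b) * coeff (n + 1 - k) (PowerSeries.mk κ) ≤
        ∑ k ∈ Finset.range (n + 1), (coeff k (compKernel b) * b (n - k) -
          coeff k (compKernel b) * b (n + 2 - k)) := by
      refine Finset.sum_le_sum fun k hk => ?_
      have hk' := Finset.mem_range.1 hk
      rw [coeff_mk, ← mul_sub]
      refine mul_le_mul_of_nonneg_left ?_ (hP k)
      rw [show n + 1 - k = n - k + 1 by omega, show n + 2 - k = n - k + 2 by omega]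
      exact hκ _
    rw [Finset.sum_sub_distrib, h1] at h3
    have h4 := antitone_coeff_compKernel hpos hlog (show n + 1 ≤ n + 2 by omega)
    simp only at h4
    have h5 := hanti (Nat.zero_le 1)
    have h6 := mul_le_mul_of_nonneg_right h4 hb0.le
    have h7 := mul_le_mul_of_nonneg_left h5 hPn
    linarith

end

/-! ### The weights of the L1 scheme -/

lemma Gamma_two_sub {α : ℝ} (hα₁ : α < 1) :
    Real.Gamma (2 - α) = (1 - α) * Real.Gamma (1 - α) := by
  rw [← Real.Gamma_add_one (sub_pos.2 hα₁).ne']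
  congr 1
  ring

lemma intervalIntegrable_rlKernel {p : ℝ} (hp : 0 < p) (x y : ℝ) :
    IntervalIntegrable (rlKernel p) volume x y :=
  (intervalIntegral.intervalIntegrable_rpow' (by linarith)).div_const _

lemma integral_rlKernel_eq_weight {α : ℝ} (hα₁ : α < 1) (i : ℕ) :
    ∫ x in (i : ℝ)..(i + 1), rlKernel (1 - α) x = weight α i := by
  have hp : 0 < 1 - α := sub_pos.2 hα₁
  have hG := Real.Gamma_pos_of_pos hp
  simp only [rlKernel]
  rw [intervalIntegral.integral_div, integral_rpow (Or.inl (by linarith)), weight,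
    Gamma_two_sub hα₁, sub_add_cancel]
  field_simp

lemma antitoneOn_rlKernel {p : ℝ} (hp : 0 < p) (hp₁ : p ≤ 1) :
    AntitoneOn (rlKernel p) (Set.Ioi 0) := fun _ hx _ _ hxy =>
  div_le_div_of_nonneg_right (Real.rpow_le_rpow_of_nonpos hx hxy (by linarith))
    (Real.Gamma_pos_of_pos hp).le

lemma rlKernel_le_weight {α : ℝ} (hα : 0 < α) (hα₁ : α < 1) (i : ℕ) :
    rlKernel (1 - α) (i + 1) ≤ weight α i := by
  have hp : 0 < 1 - α := sub_pos.2 hα₁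
  rw [← integral_rlKernel_eq_weight hα₁]
  have h := intervalIntegral.integral_mono_on_of_le_Ioo (μ := volume) (a := (i : ℝ)) (b := i + 1)
    (by linarith) (intervalIntegrable_const (c := rlKernel (1 - α) (i + 1)))
    (intervalIntegrable_rlKernel hp _ _) fun x hx =>
      antitoneOn_rlKernel hp (by linarith) (i.cast_nonneg.trans_lt hx.1)
        (show (0 : ℝ) < i + 1 by positivity) hx.2.le
  simpa using h

lemma weight_succ_le_rlKernel {α : ℝ} (hα : 0 < α) (hα₁ : α < 1) (i : ℕ) :
    weight α (i + 1) ≤ rlKernel (1 - α) (i + 1) := by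
  have hp : 0 < 1 - α := sub_pos.2 hα₁
  rw [← integral_rlKernel_eq_weight hα₁]
  push_cast
  have hi : (0 : ℝ) < i + 1 := by positivity
  have h := intervalIntegral.integral_mono_on_of_le_Ioo (μ := volume) (a := (i : ℝ) + 1)
    (b := i + 1 + 1) (by linarith) (intervalIntegrable_rlKernel hp _ _)
    (intervalIntegrable_const (c := rlKernel (1 - α) (i + 1))) fun x hx =>
      antitoneOn_rlKernel hp (by linarith) hi (hi.trans hx.1) hx.1.le
  simpa using h

lemma weight_pos {α : ℝ} (hα : 0 < α) (hα₁ : α < 1) (i : ℕ) : 0 < weight α i :=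
  (rlKernel_pos (sub_pos.2 hα₁) (by positivity)).trans_le (rlKernel_le_weight hα hα₁ i)

lemma antitone_weight {α : ℝ} (hα : 0 < α) (hα₁ : α < 1) : Antitone (weight α) :=
  antitone_nat_of_succ_le fun i =>
    (weight_succ_le_rlKernel hα hα₁ i).trans (rlKernel_le_weight hα hα₁ i)

lemma rlKernel_sq_le {α x : ℝ} (hα : 0 < α) (hx : 0 < x) :
    rlKernel (1 - α) (x + 1) ^ 2 ≤ rlKernel (1 - α) x * rlKernel (1 - α) (x + 2) := by
  simp only [rlKernel, sub_sub_cancel_left]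
  rw [div_pow, div_mul_div_comm, ← pow_two]
  refine div_le_div_of_nonneg_right ?_ (sq_nonneg _)
  rw [← Real.mul_rpow hx.le (by positivity), ← Real.rpow_natCast, ← Real.rpow_mul (by positivity),
    mul_comm (-α), Real.rpow_mul (by positivity)]
  refine Real.rpow_le_rpow_of_nonpos (by positivity) ?_ (by linarith)
  rw [Real.rpow_natCast]
  nlinarith

/-- The weights are log-convex because the kernel is: the integral of the nonnegative quadratic
polynomial `k(x) y² - 2 k(x+1) y + k(x+2)` in `y` has a nonpositive discriminant. -/
lemma weight_sq_le {α : ℝ} (hα : 0 < α) (hα₁ : α < 1) (i : ℕ) :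
    weight α (i + 1) ^ 2 ≤ weight α i * weight α (i + 2) := by
  have hp : 0 < 1 - α := sub_pos.2 hα₁
  set k := rlKernel (1 - α) with hk
  have hshift : ∀ m : ℕ, ∫ x in (i : ℝ)..(i + 1), k (x + m) = weight α (i + m) := by
    intro m
    rw [intervalIntegral.integral_comp_add_right, ← integral_rlKernel_eq_weight hα₁]
    push_cast
    congr 1
    ring
  have hint : ∀ m : ℕ, IntervalIntegrable (fun x => k (x + m)) volume (i : ℝ) (i + 1) := by
    intro m
    have h := (intervalIntegrable_rlKernel hp ((i : ℝ) + m) (i + 1 + m)).comp_add_right (m : ℝ)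
    simpa using h
  have key : ∀ y : ℝ, 0 ≤ weight α i * (y * y) + (-2 * weight α (i + 1)) * y +
      weight α (i + 2) := by
    intro y
    have e : weight α i * (y * y) + (-2 * weight α (i + 1)) * y + weight α (i + 2) =
        ∫ x in (i : ℝ)..(i + 1), (k (x + (0 : ℕ)) * (y * y) + k (x + (1 : ℕ)) * (-2 * y) +
          k (x + (2 : ℕ))) := by
      rw [intervalIntegral.integral_add (((hint 0).mul_const _).add ((hint 1).mul_const _))
        (hint 2), intervalIntegral.integral_add ((hint 0).mul_const _) ((hint 1).mul_const _),
        intervalIntegral.integral_mul_const, intervalIntegral.integral_mul_const, hshift, hshift,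
        hshift]
      ring_nf
    rw [e, intervalIntegral.integral_of_le (by linarith)]
    refine setIntegral_nonneg measurableSet_Ioc fun x hx => ?_
    have hx0 : 0 < x := i.cast_nonneg.trans_lt hx.1
    have h1 := rlKernel_sq_le hα hx0
    have h2 : 0 < k x := rlKernel_pos hp hx0
    simp only [Nat.cast_zero, add_zero, Nat.cast_one, Nat.cast_ofNat]
    rw [← hk] at h1
    have h3 : 0 ≤ k x * (k x * (y * y) + k (x + 1) * (-2 * y) + k (x + 2)) := by
      nlinarith [sq_nonneg (k x * y - k (x + 1))]
    exact nonneg_of_mul_nonneg_right h3 h2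
  have h := discrim_le_zero key
  rw [discrim] at h
  nlinarith

lemma weight_zero {α : ℝ} (hα₁ : α < 1) : weight α 0 = (Real.Gamma (2 - α))⁻¹ := by
  rw [weight]
  simp [Real.zero_rpow (sub_pos.2 hα₁).ne']

lemma sum_weight {α : ℝ} (hα₁ : α < 1) (n : ℕ) :
    ∑ i ∈ Finset.range n, weight α i = (n : ℝ) ^ (1 - α) / Real.Gamma (2 - α) := by
  have h := Finset.sum_range_sub (fun i : ℕ => (i : ℝ) ^ (1 - α) / Real.Gamma (2 - α)) n
  simp only [Nat.cast_zero, Real.zero_rpow (sub_pos.2 hα₁).ne', zero_div, sub_zero] at h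
  rw [← h]
  refine Finset.sum_congr rfl fun i _ => ?_
  rw [weight, sub_div]
  push_cast
  rfl

lemma coeff_compKernel_weight_le {α : ℝ} (hα : 0 < α) (hα₁ : α < 1) (n : ℕ) :
    PowerSeries.coeff n (compKernel (weight α)) ≤
      Real.Gamma (2 - α) * ((n : ℝ) + 1) ^ (α - 1) := by
  have hG : 0 < Real.Gamma (2 - α) := Real.Gamma_pos_of_pos (by linarith)
  have h := coeff_compKernel_mul_sum_le (weight_pos hα hα₁) (weight_sq_le hα hα₁) n
  have hn : (0 : ℝ) < (n : ℝ) + 1 := by positivity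
  have hn' : 0 < ((n : ℝ) + 1) ^ (1 - α) := Real.rpow_pos_of_pos hn _
  rw [sum_weight hα₁, ← mul_div_assoc, div_le_one hG] at h
  push_cast at h
  rw [show α - 1 = -(1 - α) by ring, Real.rpow_neg hn.le, ← div_eq_mul_inv, le_div_iff₀ hn']
  exact h

/-! ### The truncation error of the L1 scheme -/

/-- The increments `k(i) - k(i+1)` of the kernel `k(x) = x^{-α} / Γ(1-α)`, with the value
`2 b₀` for `i = 0`, where `k` is singular. -/
noncomputable def kernelVar (α : ℝ) : ℕ → ℝ
  | 0 => 2 * weight α 0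
  | i + 1 => rlKernel (1 - α) (i + 1) - rlKernel (1 - α) (i + 2)

/-- The decrements `w(j-1) - w(j)` of `w = mlW α μ`, with a multiple of `μ` for `j = 1`, where
`w` is singular. -/
noncomputable def mlWVar (α μ : ℝ) : ℕ → ℝ
  | 0 => 0
  | 1 => (Real.Gamma (1 - α) + Real.Gamma (2 - α)) * μ
  | j + 2 => mlW α μ (j + 1) - mlW α μ (j + 2)

lemma kernelVar_succ_le {α : ℝ} (hα : 0 < α) (hα₁ : α < 1) (i : ℕ) :
    kernelVar α (i + 1) ≤ weight α i - weight α (i + 2) := by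
  have h1 := rlKernel_le_weight hα hα₁ i
  have h2 := weight_succ_le_rlKernel hα hα₁ (i + 1)
  push_cast at h2
  rw [show (i : ℝ) + 1 + 1 = i + 2 by ring, show i + 1 + 1 = i + 2 from rfl] at h2
  rw [kernelVar]
  linarith

lemma mlWVar_nonneg {α μ : ℝ} (hα : 0 < α) (hα₁ : α < 1) (hμ : 0 ≤ μ) (j : ℕ) :
    0 ≤ mlWVar α μ j := by
  match j with
  | 0 => exact le_rfl
  | 1 =>
    have h1 := Real.Gamma_pos_of_pos (sub_pos.2 hα₁)
    have h2 : 0 < Real.Gamma (2 - α) := Real.Gamma_pos_of_pos (by linarith)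
    rw [mlWVar]
    positivity
  | j + 2 =>
    rw [mlWVar, sub_nonneg]
    exact antitoneOn_mlW hα hα₁ hμ (show (0 : ℝ) < j + 1 by positivity)
      (show (0 : ℝ) < j + 2 by positivity) (by linarith)

lemma sum_Ico_mlWVar {α μ : ℝ} {m n : ℕ} (hm : 1 ≤ m) (hmn : m ≤ n) :
    ∑ j ∈ Finset.Ico m n, mlWVar α μ (j + 1) = mlW α μ m - mlW α μ n := by
  induction n, hmn using Nat.le_induction with
  | base => simp
  | succ n hn ih =>
    obtain ⟨k, rfl⟩ : ∃ k, n = k + 1 := ⟨n - 1, by omega⟩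
    rw [Finset.sum_Ico_succ_top hn, ih, mlWVar]
    push_cast
    rw [show (k : ℝ) + 1 + 1 = k + 2 by ring]
    ring

lemma integral_rlKernel_sub_eq_weight {α : ℝ} (hα₁ : α < 1) (i j : ℕ) :
    ∫ s in (j : ℝ)..(j + 1), rlKernel (1 - α) ((i + j + 1 : ℕ) - s) = weight α i := by
  rw [intervalIntegral.integral_comp_sub_left, ← integral_rlKernel_eq_weight hα₁]
  push_cast
  congr 1 <;> ring

lemma intervalIntegrable_rlKernel_sub {p : ℝ} (hp : 0 < p) (c x y : ℝ) :
    IntervalIntegrable (fun s => rlKernel p (c - s)) volume x y := by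
  have h := (intervalIntegrable_rlKernel hp (c - x) (c - y)).comp_sub_left c
  simpa using h

/-- The contribution of the interval `[j, j+1]` to the truncation error at time `n = i + j + 1`.
Since `∫ (k(n-s) - b_i) ds = 0`, a constant may be subtracted from `w`, and the error is bounded
by the product of the variations of the kernel and of `w`. -/
lemma abs_truncation_le {α μ : ℝ} (hα : 0 < α) (hα₁ : α < 1) (hμ : 0 ≤ μ) (i j : ℕ) :
    |(∫ s in (j : ℝ)..(j + 1), rlKernel (1 - α) ((i + j + 1 : ℕ) - s) * mlW α μ s) -
      weight α i * ∫ s in (j : ℝ)..(j + 1), mlW α μ s| ≤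
      kernelVar α i * mlWVar α μ (j + 1) := by
  have hp : 0 < 1 - α := sub_pos.2 hα₁
  have hG1 := Real.Gamma_pos_of_pos hp
  have hG2 : 0 < Real.Gamma (2 - α) := Real.Gamma_pos_of_pos (by linarith)
  have hb0 := weight_pos hα hα₁ 0
  set n : ℕ := i + j + 1 with hn
  have hnR : (n : ℝ) = i + j + 1 := by
    rw [hn]
    push_cast
    rfl
  set k : ℝ → ℝ := fun s => rlKernel (1 - α) (n - s) with hk
  set w := mlW α μ with hw
  have hj : (0 : ℝ) < j + 1 := by positivity
  have hsub : Set.uIcc (j : ℝ) (j + 1) ⊆ Set.uIcc (0 : ℝ) n := by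
    rw [Set.uIcc_of_le (by linarith), Set.uIcc_of_le (by positivity)]
    refine Set.Icc_subset_Icc (by positivity) ?_
    rw [hnR]
    linarith [i.cast_nonneg (α := ℝ)]
  have hkw : IntervalIntegrable (fun s => k s * w s) volume (j : ℝ) (j + 1) :=
    (hasSum_rlKernel_conv_mlW hα hp (by positivity : (0 : ℝ) < n) μ).2.mono_set hsub
  have hwi : IntervalIntegrable w volume (j : ℝ) (j + 1) :=
    (intervalIntegrable_mlW hα (by positivity : (0 : ℝ) < n) μ).mono_set hsub
  have hki : IntervalIntegrable k volume (j : ℝ) (j + 1) := intervalIntegrable_rlKernel_sub hp _ _ _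
  have hkint : ∫ s in (j : ℝ)..(j + 1), k s = weight α i := integral_rlKernel_sub_eq_weight hα₁ i j
  have hle : (j : ℝ) ≤ j + 1 := by linarith
  have hanti := antitoneOn_mlW hα hα₁ hμ
  have hkpos : ∀ s ∈ Set.Ioo (j : ℝ) (j + 1), 0 < k s := by
    intro s hs
    refine rlKernel_pos hp ?_
    rw [hnR]
    linarith [hs.2, i.cast_nonneg (α := ℝ)]
  have hwsub : ∀ s ∈ Set.Ioo (j : ℝ) (j + 1), 0 ≤ w s - w (j + 1) := fun s hs =>
    sub_nonneg.2 (hanti (j.cast_nonneg.trans_lt hs.1) hj hs.2.le)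
  -- the constant `w (j + 1)` is subtracted from `w`
  have hterm : (∫ s in (j : ℝ)..(j + 1), k s * w s) - weight α i * ∫ s in (j : ℝ)..(j + 1), w s =
      ∫ s in (j : ℝ)..(j + 1), (k s - weight α i) * (w s - w (j + 1)) := by
    have e : ∀ s, (k s - weight α i) * (w s - w (j + 1)) =
        k s * w s - weight α i * w s - (k s * w (j + 1) - weight α i * w (j + 1)) :=
      fun s => by ring
    simp_rw [e]
    rw [intervalIntegral.integral_sub (hkw.sub (hwi.const_mul _))
      ((hki.mul_const _).sub intervalIntegrable_const),
      intervalIntegral.integral_sub hkw (hwi.const_mul _),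
      intervalIntegral.integral_sub (hki.mul_const _) intervalIntegrable_const,
      intervalIntegral.integral_const_mul, intervalIntegral.integral_mul_const, hkint,
      intervalIntegral.integral_const]
    simp
  have hprod : IntervalIntegrable (fun s => (k s - weight α i) * (w s - w (j + 1))) volume
      (j : ℝ) (j + 1) := by
    have h := (hkw.sub (hwi.const_mul (weight α i))).sub
      ((hki.sub (intervalIntegrable_const (c := weight α i))).mul_const (w (j + 1)))
    refine h.congr_ae (Filter.Eventually.of_forall fun s => ?_)
    simp only
    ring
  rcases i with _ | i
  · rcases j with _ | j
    · -- both singularities: the two terms are bounded separately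
      have h1 : (n : ℝ) = 1 := by simp [hnR]
      have h2 := integral_rlKernel_mul_mlW hα hα₁ one_pos μ
      have h3 := integral_mlW hα one_pos μ
      have hE1 := one_sub_mlE_one_le hα hα₁ hμ
      have hE2 := mlE_le_one hα hα₁ hμ (one_pos (α := ℝ))
      have hE3 : 0 ≤ μ * mlE α μ 1 := by
        rw [← h2, intervalIntegral.integral_of_le zero_le_one, integral_Ioc_eq_integral_Ioo]
        exact setIntegral_nonneg measurableSet_Ioo fun s hs => mul_nonneg
          (rlKernel_pos hp (sub_pos.2 hs.2)).le (mlW_nonneg hα hα₁ hμ hs.1)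
      simp only [hw, h1, Nat.cast_zero, zero_add, kernelVar, mlWVar]
      rw [h2, h3]
      have hb : weight α 0 * Real.Gamma (2 - α) = 1 := by
        rw [weight_zero hα₁]
        exact inv_mul_cancel₀ hG2.ne'
      have h4 : μ * mlE α μ 1 ≤ μ := mul_le_of_le_one_right hμ hE2
      have h5 := mul_le_mul_of_nonneg_left hE1 hb0.le
      have h6 : 0 ≤ weight α 0 * (1 - mlE α μ 1) := mul_nonneg hb0.le (sub_nonneg.2 hE2)
      have h7 : 2 * weight α 0 * ((Real.Gamma (1 - α) + Real.Gamma (2 - α)) * μ) =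
          2 * (weight α 0 * (Real.Gamma (1 - α) * μ)) + 2 * μ := by
        linear_combination (2 * μ) * hb
      have h8 : 0 ≤ weight α 0 * (Real.Gamma (1 - α) * μ) := by positivity
      rw [h7, abs_le]
      constructor <;> linarith
    · -- the singularity of the kernel
      have hbd : ∀ s ∈ Set.Ioo ((j + 1 : ℕ) : ℝ) ((j + 1 : ℕ) + 1),
          |(k s - weight α 0) * (w s - w ((j + 1 : ℕ) + 1))| ≤
            (k s + weight α 0) * mlWVar α μ (j + 1 + 1) := by
        intro s hs
        have h1 := hkpos s hs
        have h2 := hwsub s hs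
        rw [abs_mul, abs_of_nonneg h2]
        have h3 : |k s - weight α 0| ≤ k s + weight α 0 := by
          rw [abs_le]
          constructor <;> linarith
        have h4 : w s - w ((j + 1 : ℕ) + 1) ≤ mlWVar α μ (j + 1 + 1) := by
          rw [mlWVar]
          have h5 := hanti (show (0 : ℝ) < (j + 1 : ℕ) by positivity)
            (show (0 : ℝ) < s from (Nat.cast_nonneg _).trans_lt hs.1) hs.1.le
          push_cast at h5 ⊢
          rw [show (j : ℝ) + 1 + 1 = j + 2 by ring]
          linarith
        exact mul_le_mul h3 h4 h2 (by positivity)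
      rw [hterm]
      refine (intervalIntegral.abs_integral_le_integral_abs hle).trans ?_
      refine (intervalIntegral.integral_mono_on_of_le_Ioo hle hprod.abs
        ((hki.add intervalIntegrable_const).mul_const _) hbd).trans_eq ?_
      rw [intervalIntegral.integral_mul_const,
        intervalIntegral.integral_add hki intervalIntegrable_const, hkint,
        intervalIntegral.integral_const, kernelVar]
      simp only [add_sub_cancel_left, one_smul]
      ring
  · have hi0 : (0 : ℝ) < (i : ℝ) + 1 := by positivity
    have hkbd : ∀ s ∈ Set.Ioo (j : ℝ) (j + 1),
        |k s - weight α (i + 1)| ≤ kernelVar α (i + 1) := by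
      intro s hs
      have e : (n : ℝ) - s = i + 1 + (j + 1 - s) := by
        rw [hnR]
        push_cast
        ring
      have hkanti := antitoneOn_rlKernel hp (by linarith)
      have h1 : k s ≤ rlKernel (1 - α) (i + 1) := by
        refine hkanti hi0 ?_ ?_
        · rw [e]
          exact add_pos hi0 (by linarith [hs.2])
        · rw [e]
          linarith [hs.2]
      have h2 : rlKernel (1 - α) (i + 2) ≤ k s := by
        refine hkanti ?_ (show (0 : ℝ) < i + 2 by positivity) ?_
        · rw [e]
          exact add_pos hi0 (by linarith [hs.2])
        · rw [e]
          linarith [hs.1]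
      have h3 := weight_succ_le_rlKernel hα hα₁ i
      have h4 := rlKernel_le_weight hα hα₁ (i + 1)
      push_cast at h4
      rw [show (i : ℝ) + 1 + 1 = i + 2 by ring] at h4
      rw [kernelVar, abs_le]
      constructor <;> linarith
    have hkv : 0 ≤ kernelVar α (i + 1) :=
      (abs_nonneg _).trans (hkbd (j + 1 / 2) ⟨by linarith, by linarith⟩)
    have hW : ∫ s in (j : ℝ)..(j + 1), (w s - w (j + 1)) ≤ mlWVar α μ (j + 1) := by
      rcases j with _ | j
      · have h1 := one_sub_mlE_one_le hα hα₁ hμ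
        have h2 := integral_mlW hα one_pos μ
        have h3 := mlW_nonneg hα hα₁ hμ (one_pos (α := ℝ))
        rw [intervalIntegral.integral_sub hwi intervalIntegrable_const]
        simp only [Nat.cast_zero, zero_add, hw, intervalIntegral.integral_const, sub_zero,
          one_smul, mlWVar]
        rw [h2]
        have h4 : 0 ≤ Real.Gamma (2 - α) * μ := by positivity
        linarith
      · have h1 : ∀ s ∈ Set.Ioo ((j + 1 : ℕ) : ℝ) ((j + 1 : ℕ) + 1),
            w s - w ((j + 1 : ℕ) + 1) ≤ mlWVar α μ (j + 1 + 1) := by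
          intro s hs
          have h5 := hanti (show (0 : ℝ) < (j + 1 : ℕ) by positivity)
            (show (0 : ℝ) < s from (Nat.cast_nonneg _).trans_lt hs.1) hs.1.le
          rw [mlWVar]
          push_cast at h5 ⊢
          rw [show (j : ℝ) + 1 + 1 = j + 2 by ring]
          exact sub_le_sub_right h5 _
        have h2 := intervalIntegral.integral_mono_on_of_le_Ioo hle
          (hwi.sub intervalIntegrable_const) intervalIntegrable_const h1
        simpa using h2
    rw [hterm]
    refine (intervalIntegral.abs_integral_le_integral_abs hle).trans ?_
    refine (intervalIntegral.integral_mono_on_of_le_Ioo hle hprod.abs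
      ((hwi.sub (intervalIntegrable_const (c := w (j + 1)))).const_mul (kernelVar α (i + 1)))
      fun s hs => ?_).trans ?_
    · rw [abs_mul, abs_of_nonneg (hwsub s hs)]
      exact mul_le_mul_of_nonneg_right (hkbd s hs) (hwsub s hs)
    · rw [intervalIntegral.integral_const_mul]
      exact mul_le_mul_of_nonneg_left hW hkv

open PowerSeries in
/-- The truncation error of the L1 scheme with unit step for the Mittag-Leffler function. -/
lemma abs_fracDiff_mlE_le {α μ : ℝ} (hα : 0 < α) (hα₁ : α < 1) (hμ : 0 ≤ μ) {n : ℕ} (hn : 1 ≤ n) :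
    |coeff n (PowerSeries.mk (weight α) * ((1 - X) * PowerSeries.mk fun j : ℕ => mlE α μ j - 1)) +
      μ * mlE α μ n| ≤
      coeff n (PowerSeries.mk (kernelVar α) * PowerSeries.mk (mlWVar α μ)) := by
  have hp : 0 < 1 - α := sub_pos.2 hα₁
  have hnR : (0 : ℝ) < n := by positivity
  have hsub : ∀ j < n, Set.uIcc (j : ℝ) ((j + 1 : ℕ) : ℝ) ⊆ Set.uIcc (0 : ℝ) n := by
    intro j hj
    rw [Set.uIcc_of_le (by simp), Set.uIcc_of_le hnR.le]
    exact Set.Icc_subset_Icc (by positivity) (by exact_mod_cast hj)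
  have h1 : μ * mlE α μ n = ∑ j ∈ Finset.range n,
      ∫ s in (j : ℝ)..((j + 1 : ℕ) : ℝ), rlKernel (1 - α) (n - s) * mlW α μ s := by
    rw [intervalIntegral.sum_integral_adjacent_intervals (a := fun j : ℕ => (j : ℝ))
      (fun j hj => (hasSum_rlKernel_conv_mlW hα hp hnR μ).2.mono_set (hsub j hj)),
      Nat.cast_zero, integral_rlKernel_mul_mlW hα hα₁ hnR]
  have h2 : ∀ j < n, mlE α μ ((j + 1 : ℕ) : ℝ) - mlE α μ j =
      -∫ s in (j : ℝ)..((j + 1 : ℕ) : ℝ), mlW α μ s := by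
    intro j hj
    have h3 := integral_mlW hα (t := ((j + 1 : ℕ) : ℝ)) (by positivity) μ
    rcases Nat.eq_zero_or_pos j with rfl | hj0
    · rw [Nat.cast_zero, h3, mlE_zero hα]
      ring
    · have hj0' : (0 : ℝ) < j := by exact_mod_cast hj0
      have h4 := integral_mlW hα hj0' μ
      rw [← intervalIntegral.integral_add_adjacent_intervals (intervalIntegrable_mlW hα hj0' μ)
        ((intervalIntegrable_mlW hα hnR μ).mono_set (hsub j hj)), h4] at h3
      linarith
  rw [coeff_fracDiff_eq_sum_increments (by simp [mlE_zero hα]), h1, ← Finset.sum_add_distrib,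
    mul_comm (PowerSeries.mk (kernelVar α)), coeff_mul_range, Finset.sum_range_succ']
  simp only [coeff_mk]
  rw [show mlWVar α μ 0 = 0 from rfl, zero_mul, add_zero]
  refine (Finset.abs_sum_le_sum_abs _ _).trans (Finset.sum_le_sum fun j hj => ?_)
  have hj' := Finset.mem_range.1 hj
  have h3 := abs_truncation_le hα hα₁ hμ (n - (j + 1)) j
  rw [show n - (j + 1) + j + 1 = n by omega, mul_comm (kernelVar α _)] at h3
  refine le_trans (le_of_eq ?_) h3
  rw [sub_sub_sub_cancel_right, h2 j hj']
  push_cast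
  congr 1
  ring

/-! ### The error of the L1 scheme for a scalar equation -/

section

open PowerSeries

/-- The sum is split at half of `n`: in the first half the complementary kernel is of order
`n^{α-1}`, in the second half the decrements of `w` add up to a term of that order. -/
lemma coeff_compKernel_mul_mlWVar_le {α μ : ℝ} (hα : 0 < α) (hα₁ : α < 1) (hμ : 0 ≤ μ) {n : ℕ}
    (hn : 1 ≤ n) :
    coeff n (compKernel (weight α) * PowerSeries.mk (mlWVar α μ)) ≤
      Real.Gamma (2 - α) * (Real.Gamma (1 - α) + 3 * Real.Gamma (2 - α)) *
        ((n : ℝ) / 2) ^ (α - 1) * μ := by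
  have hG1 := Real.Gamma_pos_of_pos (sub_pos.2 hα₁)
  have hG2 : 0 < Real.Gamma (2 - α) := Real.Gamma_pos_of_pos (by linarith)
  have hnR : (0 : ℝ) < n := by exact_mod_cast hn
  have hP := coeff_compKernel_nonneg (weight_pos hα hα₁) (antitone_weight hα hα₁)
    (weight_sq_le hα hα₁)
  have hδ := mlWVar_nonneg hα hα₁ hμ
  set q : ℝ := ((n : ℝ) / 2) ^ (α - 1) with hq
  have hq0 : 0 < q := Real.rpow_pos_of_pos (by positivity) _
  set m : ℕ := (n + 1) / 2 with hm
  have hm1 : 1 ≤ m := by omega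
  have hmn : m ≤ n := by omega
  have hm2 : (n : ℝ) / 2 ≤ m := by
    have : n ≤ 2 * m := by omega
    have : (n : ℝ) ≤ 2 * m := by exact_mod_cast this
    linarith
  rw [mul_comm, coeff_mul_range, Finset.sum_range_succ']
  simp only [coeff_mk]
  rw [show mlWVar α μ 0 = 0 from rfl, zero_mul, add_zero, Finset.range_eq_Ico,
    ← Finset.sum_Ico_consecutive _ (Nat.zero_le m) hmn]
  have hfirst : ∑ j ∈ Finset.Ico 0 m, mlWVar α μ (j + 1) *
      coeff (n - (j + 1)) (compKernel (weight α)) ≤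
      (Real.Gamma (1 - α) + 2 * Real.Gamma (2 - α)) * μ * (Real.Gamma (2 - α) * q) := by
    have h1 : ∑ j ∈ Finset.Ico 0 m, mlWVar α μ (j + 1) ≤
        (Real.Gamma (1 - α) + 2 * Real.Gamma (2 - α)) * μ := by
      rw [← Finset.sum_Ico_consecutive _ (Nat.zero_le 1) hm1, sum_Ico_mlWVar le_rfl hm1]
      simp only [Nat.Ico_zero_eq_range, Finset.range_one, Finset.sum_singleton,
        mlWVar, Nat.cast_one]
      have h2 := mlW_le hα hα₁ hμ one_pos
      have h3 := mlW_nonneg hα hα₁ hμ (show (0 : ℝ) < m by exact_mod_cast hm1)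
      rw [Real.one_rpow, mul_one] at h2
      linarith
    refine le_trans ?_ (mul_le_mul_of_nonneg_right h1 (by positivity))
    rw [Finset.sum_mul]
    refine Finset.sum_le_sum fun j hj => mul_le_mul_of_nonneg_left ?_ (hδ _)
    have hj' := (Finset.mem_Ico.1 hj).2
    refine (coeff_compKernel_weight_le hα hα₁ _).trans (mul_le_mul_of_nonneg_left ?_ hG2.le)
    refine Real.rpow_le_rpow_of_nonpos (by positivity) ?_ (by linarith)
    have : n ≤ 2 * (n - (j + 1) + 1) := by omega
    have : (n : ℝ) ≤ 2 * (((n - (j + 1) : ℕ) : ℝ) + 1) := by exact_mod_cast this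
    linarith
  have hsecond : ∑ j ∈ Finset.Ico m n, mlWVar α μ (j + 1) *
      coeff (n - (j + 1)) (compKernel (weight α)) ≤
      Real.Gamma (2 - α) * μ * q * Real.Gamma (2 - α) := by
    have h1 : ∑ j ∈ Finset.Ico m n, mlWVar α μ (j + 1) ≤ Real.Gamma (2 - α) * μ * q := by
      rw [sum_Ico_mlWVar hm1 hmn]
      have hmR : (0 : ℝ) < m := by exact_mod_cast hm1
      have h2 := mlW_le hα hα₁ hμ hmR
      have h3 := mlW_nonneg hα hα₁ hμ hnR
      have h4 : (m : ℝ) ^ (α - 1) ≤ q :=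
        Real.rpow_le_rpow_of_nonpos (by positivity) hm2 (by linarith)
      have h5 : Real.Gamma (2 - α) * μ * (m : ℝ) ^ (α - 1) ≤ Real.Gamma (2 - α) * μ * q :=
        mul_le_mul_of_nonneg_left h4 (by positivity)
      linarith
    refine le_trans ?_ (mul_le_mul_of_nonneg_right h1 hG2.le)
    rw [Finset.sum_mul]
    refine Finset.sum_le_sum fun j _ => mul_le_mul_of_nonneg_left ?_ (hδ _)
    refine (antitone_coeff_compKernel (weight_pos hα hα₁) (weight_sq_le hα hα₁)
      (Nat.zero_le _)).trans ?_
    simpa using coeff_compKernel_weight_le hα hα₁ 0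
  calc _ ≤ _ := add_le_add hfirst hsecond
    _ = _ := by ring

/-- The constant in the error estimate. -/
noncomputable def errorConst (α : ℝ) : ℝ :=
  4 * weight α 0 * (Real.Gamma (2 - α) * (Real.Gamma (1 - α) + 3 * Real.Gamma (2 - α)) *
    (1 / 2 : ℝ) ^ (α - 1))

lemma errorConst_pos {α : ℝ} (hα : 0 < α) (hα₁ : α < 1) : 0 < errorConst α := by
  have hG1 := Real.Gamma_pos_of_pos (sub_pos.2 hα₁)
  have hG2 : 0 < Real.Gamma (2 - α) := Real.Gamma_pos_of_pos (by linarith)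
  have hb := weight_pos hα hα₁ 0
  unfold errorConst
  positivity

/-- The L1 scheme in terms of the fractional difference of `U - U⁰`. -/
lemma fracDiff_of_scheme {b U : ℕ → ℝ} {μ : ℝ} {n : ℕ} (hn : 1 ≤ n)
    (h : b 0 * U n + μ * U n = b (n - 1) * U 0 +
      ∑ j ∈ Finset.Icc 1 (n - 1), (b (j - 1) - b j) * U (n - j)) :
    coeff n (PowerSeries.mk b * ((1 - X) * PowerSeries.mk fun j => U j - U 0)) =
      -(μ * U n) := by
  obtain ⟨m, rfl⟩ : ∃ m, n = m + 1 := ⟨n - 1, by omega⟩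
  have h1 : ∑ j ∈ Finset.Icc 1 m, (b (j - 1) - b j) * U (m + 1 - j) =
      ∑ k ∈ Finset.range m, (b k - b (k + 1)) * U (m - k) := by
    refine (Finset.sum_nbij' (fun k => k + 1) (fun j => j - 1) ?_ ?_ ?_ ?_ ?_).symm
    · intro k hk
      rw [Finset.mem_range] at hk
      rw [Finset.mem_Icc]
      omega
    · intro k hk
      rw [Finset.mem_Icc] at hk
      rw [Finset.mem_range]
      omega
    · intro k _
      omega
    · intro k hk
      rw [Finset.mem_Icc] at hk
      omega
    · intro k _
      rw [Nat.add_sub_cancel, Nat.add_sub_add_right]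
  rw [Nat.add_sub_cancel, h1] at h
  have h2 : ∑ k ∈ Finset.range m, (b k - b (k + 1)) = b 0 - b m := Finset.sum_range_sub' b m
  rw [coeff_fracDiff, Finset.sum_range_succ]
  simp only [Nat.add_sub_cancel, Nat.sub_self, sub_self, mul_zero, add_zero, mul_sub]
  rw [Finset.sum_sub_distrib, ← Finset.sum_mul, h2]
  linear_combination h

/-- The error estimate for a scalar equation and unit step, uniformly in `μ`. -/
lemma abs_mlE_sub_scheme_le {α μ : ℝ} (hα : 0 < α) (hα₁ : α < 1) (hμ : 0 ≤ μ) {N : ℕ} {U : ℕ → ℝ}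
    (h : ∀ n : ℕ, 1 ≤ n → n ≤ N → weight α 0 * U n + μ * U n = weight α (n - 1) * U 0 +
      ∑ j ∈ Finset.Icc 1 (n - 1), (weight α (j - 1) - weight α j) * U (n - j))
    {n : ℕ} (hn : 1 ≤ n) (hnN : n ≤ N) :
    |U 0 * mlE α μ n - U n| ≤ errorConst α * (n : ℝ) ^ (α - 1) * (μ * |U 0|) := by
  have hpos := weight_pos hα hα₁
  have hanti := antitone_weight hα hα₁
  have hlog := weight_sq_le hα hα₁
  have hP := coeff_compKernel_nonneg hpos hanti hlog
  set ρ : ℕ → ℝ := fun m =>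
    |U 0| * coeff m (PowerSeries.mk (kernelVar α) * PowerSeries.mk (mlWVar α μ)) with hρ
  have he : PowerSeries.mk (fun j : ℕ => U 0 * mlE α μ j - U j) =
      U 0 • (PowerSeries.mk fun j : ℕ => mlE α μ j - 1) - PowerSeries.mk fun j => U j - U 0 := by
    ext j
    simp
    ring
  have hmain := abs_le_of_fracDiff hpos hanti hlog
    (e := fun j : ℕ => U 0 * mlE α μ j - U j) (ρ := ρ) hμ (N := N) (by simp [mlE_zero hα])
    (by simp [hρ, coeff_mul_range, mlWVar]) (fun m hm hmN => by
      rw [he, mul_sub, mul_smul_comm, mul_sub, mul_smul_comm, map_sub, map_smul,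
        fracDiff_of_scheme hm (h m hm hmN)]
      have h1 := mul_le_mul_of_nonneg_left (abs_fracDiff_mlE_le hα hα₁ hμ hm) (abs_nonneg (U 0))
      rw [← abs_mul] at h1
      refine le_trans (le_of_eq ?_) h1
      rw [smul_eq_mul]
      congr 1
      ring) hnN
  have hρs : PowerSeries.mk ρ =
      |U 0| • (PowerSeries.mk (kernelVar α) * PowerSeries.mk (mlWVar α μ)) := by
    ext m
    simp [hρ]
  rw [hρs, mul_smul_comm, map_smul, smul_eq_mul, ← mul_assoc (compKernel _)] at hmain
  have h2 : coeff n (compKernel (weight α) * PowerSeries.mk (kernelVar α) *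
      PowerSeries.mk (mlWVar α μ)) ≤
      4 * weight α 0 * coeff n (compKernel (weight α) * PowerSeries.mk (mlWVar α μ)) := by
    rw [coeff_mul_range, coeff_mul_range, Finset.mul_sum]
    refine Finset.sum_le_sum fun k _ => ?_
    rw [← mul_assoc]
    refine mul_le_mul_of_nonneg_right ?_ ?_
    · exact coeff_compKernel_mul_le hpos hanti hlog rfl (kernelVar_succ_le hα hα₁) k
    · rw [coeff_mk]
      exact mlWVar_nonneg hα hα₁ hμ _
  have h3 := mul_le_mul_of_nonneg_left (coeff_compKernel_mul_mlWVar_le hα hα₁ hμ hn)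
    (mul_nonneg zero_le_four (hpos 0).le)
  refine hmain.trans ((mul_le_mul_of_nonneg_left (h2.trans h3) (abs_nonneg (U 0))).trans_eq ?_)
  rw [errorConst, div_eq_mul_one_div (n : ℝ) 2, Real.mul_rpow n.cast_nonneg (by norm_num)]
  ring

/-- The error estimate for a scalar equation, by rescaling the time variable. -/
lemma abs_caputo_sub_scheme_le {α T ν : ℝ} (hα : 0 < α) (hα₁ : α < 1) (hT : 0 < T) (hν : 0 ≤ ν)
    {N : ℕ} {y y' : ℝ → ℝ} {U : ℕ → ℝ}
    (hc : ContinuousOn y (Set.Icc 0 T)) (hd : ∀ s ∈ Set.Ioo 0 T, HasDerivAt y (y' s) s)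
    (hi : ∀ t ∈ Set.Ioc 0 T, IntervalIntegrable (fun s => (t - s) ^ (-α) * y' s) volume 0 t)
    (he : ∀ t ∈ Set.Ioc 0 T, (Real.Gamma (1 - α))⁻¹ *
      (∫ s in (0 : ℝ)..t, (t - s) ^ (-α) * y' s) + ν * y t = 0)
    (h : ∀ n : ℕ, 1 ≤ n → n ≤ N → weight α 0 * U n + (T / N) ^ α * (ν * U n) =
      weight α (n - 1) * U 0 +
        ∑ j ∈ Finset.Icc 1 (n - 1), (weight α (j - 1) - weight α j) * U (n - j))
    (h0 : y 0 = U 0) {n : ℕ} (hn : 1 ≤ n) (hnN : n ≤ N) :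
    |y (n * (T / N)) - U n| ≤
      errorConst α * (T / N) * (n * (T / N)) ^ (α - 1) * |ν * U 0| := by
  have hN : (0 : ℝ) < N := by exact_mod_cast hn.trans hnN
  have hnR : (0 : ℝ) < n := by exact_mod_cast hn
  have hτ : 0 < T / N := div_pos hT hN
  have ht : (n : ℝ) * (T / N) ∈ Set.Icc 0 T := by
    refine ⟨by positivity, ?_⟩
    rw [← mul_div_assoc, div_le_iff₀ hN, mul_comm]
    exact mul_le_mul_of_nonneg_left (by exact_mod_cast hnN) hT.le
  rw [eq_mlE_of_caputo hα hα₁ hν hc hd hi he ht, h0, mlE_scale hτ ν hnR]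
  refine (abs_mlE_sub_scheme_le (μ := ν * (T / N) ^ α) hα hα₁ (by positivity)
    (fun m hm hmN => by rw [← h m hm hmN]; ring) hn hnN).trans_eq ?_
  rw [Real.mul_rpow hnR.le hτ.le, Real.rpow_sub_one hτ.ne', abs_mul, abs_of_nonneg hν]
  field_simp

end

/-! ### Diagonalization of the discrete problem -/

/-- The error estimate for the problem `∂_t^α u + A u = 0` with a symmetric
positive semidefinite operator `A` on a finite-dimensional Hilbert space. -/
lemma norm_caputo_sub_scheme_le {X : Type*} [NormedAddCommGroup X] [InnerProductSpace ℝ X]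
    [FiniteDimensional ℝ X] {A : X →L[ℝ] X} (hsymm : (A : X →ₗ[ℝ] X).IsSymmetric)
    (hnonneg : ∀ x, 0 ≤ inner ℝ (A x) x)
    {α T : ℝ} (hα : 0 < α) (hα₁ : α < 1) (hT : 0 < T) {N : ℕ} {u : ℝ → X} {U : ℕ → X}
    (hc : ContinuousOn u (Set.Icc 0 T)) (hd : ∀ s ∈ Set.Ioo 0 T, DifferentiableAt ℝ u s)
    (hi : ∀ t ∈ Set.Ioc 0 T, IntervalIntegrable (fun s => (t - s) ^ (-α) • deriv u s) volume 0 t)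
    (he : ∀ t ∈ Set.Ioc 0 T, caputo α u t + A (u t) = 0)
    (h : ∀ n : ℕ, 1 ≤ n → n ≤ N → weight α 0 • U n + (T / N) ^ α • A (U n) =
      weight α (n - 1) • U 0 +
        ∑ j ∈ Finset.Icc 1 (n - 1), (weight α (j - 1) - weight α j) • U (n - j))
    (h0 : u 0 = U 0) {n : ℕ} (hn : 1 ≤ n) (hnN : n ≤ N) :
    ‖u (n * (T / N)) - U n‖ ≤
      errorConst α * (T / N) * (n * (T / N)) ^ (α - 1) * ‖A (U 0)‖ := by
  set e := hsymm.eigenvectorBasis rfl with hedef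
  set ν := hsymm.eigenvalues rfl with hνdef
  have hAe : ∀ i, A (e i) = ν i • e i := fun i => hsymm.apply_eigenvectorBasis rfl i
  have hinner : ∀ i x, inner ℝ (e i) (A x) = ν i * inner ℝ (e i) x := by
    intro i x
    have h1 : inner ℝ (A (e i)) x = inner ℝ (e i) (A x) := hsymm (e i) x
    rw [← h1, hAe, real_inner_smul_left]
  have hν : ∀ i, 0 ≤ ν i := by
    intro i
    have h1 := hnonneg (e i)
    rwa [hAe, real_inner_smul_left, real_inner_self_eq_norm_sq, e.norm_eq_one, one_pow,
      mul_one] at h1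
  have hNpos : (0 : ℝ) < N := by exact_mod_cast hn.trans hnN
  have hτ : 0 < T / N := div_pos hT hNpos
  set c : ℝ := errorConst α * (T / N) * (n * (T / N)) ^ (α - 1) with hcdef
  have hc0 : 0 ≤ c := by
    have := errorConst_pos hα hα₁
    positivity
  have hcoord : ∀ i, |inner ℝ (e i) (u (n * (T / N)) - U n)| ≤ c * |inner ℝ (e i) (A (U 0))| := by
    intro i
    rw [inner_sub_right, hinner]
    have hcomp : ∀ t ∈ Set.Ioc 0 T, ∫ s in (0 : ℝ)..t, (t - s) ^ (-α) * inner ℝ (e i) (deriv u s) =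
        inner ℝ (e i) (∫ s in (0 : ℝ)..t, (t - s) ^ (-α) • deriv u s) := by
      intro t ht
      have h1 := (innerSL ℝ (e i)).intervalIntegral_comp_comm (hi t ht)
      simpa [real_inner_smul_right] using h1
    refine abs_caputo_sub_scheme_le (y := fun s => inner ℝ (e i) (u s))
      (y' := fun s => inner ℝ (e i) (deriv u s)) (U := fun m => inner ℝ (e i) (U m)) hα hα₁ hT
      (hν i) (continuousOn_const.inner hc) (fun s hs => ?_) (fun t ht => ?_) (fun t ht => ?_)
      (fun m hm hmN => ?_) (by rw [h0]) hn hnN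
    · have h1 := (innerSL ℝ (e i)).hasFDerivAt.comp_hasDerivAt s (hd s hs).hasDerivAt
      exact h1
    · have h1 := hi t ht
      have h2 : IntervalIntegrable (fun s => innerSL ℝ (e i) ((t - s) ^ (-α) • deriv u s))
          volume 0 t :=
        ⟨(innerSL ℝ (e i)).integrable_comp h1.1, (innerSL ℝ (e i)).integrable_comp h1.2⟩
      simpa [real_inner_smul_right] using h2
    · have h1 := congrArg (fun x => inner ℝ (e i) x) (he t ht)
      simp only [inner_add_right, caputo, real_inner_smul_right, hinner, inner_zero_right] at h1
      rw [hcomp t ht]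
      exact h1
    · have h1 := congrArg (fun x => inner ℝ (e i) x) (h m hm hmN)
      simpa only [inner_add_right, inner_sum, real_inner_smul_right, hinner] using h1
  rw [← abs_of_nonneg (norm_nonneg (u _ - U n)), ← abs_of_nonneg (mul_nonneg hc0 (norm_nonneg _)),
    ← sq_le_sq, mul_pow, ← e.sum_sq_norm_inner_right, ← e.sum_sq_norm_inner_right, Finset.mul_sum]
  refine Finset.sum_le_sum fun i _ => ?_
  rw [← mul_pow]
  exact pow_le_pow_left₀ (norm_nonneg _) (hcoord i) 2

/-! ### Stability of the Ritz projection -/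

variable {d : ℕ} {Ω : Opens (Space d)}

lemma inner_toLp (p : L2 Ω) {φ : Space d → ℝ}
    (hφ : MemLp φ 2 ((volume : Measure (Space d)).restrict (Ω : Set (Space d)))) :
    inner ℝ p hφ.toLp = ∫ x in (Ω : Set (Space d)), p x * φ x := by
  rw [L2.inner_def]
  refine integral_congr_ae ?_
  filter_upwards [hφ.coeFn_toLp] with x hx
  rw [hx]
  simp [mul_comm]

lemma norm_sub_toLp_lt (p : L2 Ω) {φ : Space d → ℝ}
    (hφ : MemLp φ 2 ((volume : Measure (Space d)).restrict (Ω : Set (Space d)))) {ε : ℝ}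
    (hε : 0 < ε) (h : eLpNorm (fun x => p x - φ x) 2
      ((volume : Measure (Space d)).restrict (Ω : Set (Space d))) < ENNReal.ofReal ε) :
    ‖p - hφ.toLp‖ < ε := by
  have e : (p - hφ.toLp : L2 Ω) =ᵐ[(volume : Measure (Space d)).restrict (Ω : Set (Space d))]
      fun x => p x - φ x := by
    filter_upwards [Lp.coeFn_sub p hφ.toLp, hφ.coeFn_toLp] with x h1 h2
    rw [h1, Pi.sub_apply, h2]
  rw [Lp.norm_def, eLpNorm_congr_ae e, ← ENNReal.toReal_ofReal hε.le]
  exact (ENNReal.toReal_lt_toReal h.ne_top ENNReal.ofReal_ne_top).2 h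

/-- Integration by parts, for `H¹₀` by density of the test functions. -/
lemma inner_weakPartial_eq_neg {p χ : L2 Ω} (hp : p ∈ H1 Ω) (hχ : χ ∈ H10 Ω) (i : Fin d) :
    inner ℝ p (weakPartial i χ) = -inner ℝ (weakPartial i p) χ := by
  rw [← sub_eq_zero, sub_neg_eq_add, ← abs_nonpos_iff]
  refine le_of_forall_pos_le_add fun ε hε => ?_
  set C := ‖p‖ + ‖weakPartial i p‖ + 1 with hC
  have hC0 : 0 < C := by positivity
  have hη : 0 < ε / C := div_pos hε hC0
  obtain ⟨φ, hφ, h1, h2⟩ := hχ.2 (ENNReal.ofReal (ε / C)) (ENNReal.ofReal_pos.2 hη)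
  have h3 := norm_sub_toLp_lt χ hφ.memLp hη h1
  have h4 := norm_sub_toLp_lt (weakPartial i χ) (hφ.memLp_partial i) hη (h2 i)
  have h5 : inner ℝ p (hφ.memLp_partial i).toLp = -inner ℝ (weakPartial i p) hφ.memLp.toLp := by
    rw [inner_toLp, inner_toLp]
    exact hasWeakPartial_weakPartial hp i φ hφ
  have h6 : inner ℝ p (weakPartial i χ) + inner ℝ (weakPartial i p) χ =
      inner ℝ p (weakPartial i χ - (hφ.memLp_partial i).toLp) +
        inner ℝ (weakPartial i p) (χ - hφ.memLp.toLp) := by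
    rw [inner_sub_right, inner_sub_right, h5]
    ring
  rw [h6, zero_add]
  calc |inner ℝ p (weakPartial i χ - (hφ.memLp_partial i).toLp) +
        inner ℝ (weakPartial i p) (χ - hφ.memLp.toLp)|
      ≤ ‖p‖ * ‖weakPartial i χ - (hφ.memLp_partial i).toLp‖ +
        ‖weakPartial i p‖ * ‖χ - hφ.memLp.toLp‖ :=
        (abs_add_le _ _).trans (add_le_add (abs_real_inner_le_norm _ _)
          (abs_real_inner_le_norm _ _))
    _ ≤ ‖p‖ * (ε / C) + ‖weakPartial i p‖ * (ε / C) := by gcongr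
    _ ≤ C * (ε / C) := by
        rw [← add_mul]
        refine mul_le_mul_of_nonneg_right ?_ hη.le
        rw [hC]
        linarith
    _ = ε := mul_div_cancel₀ _ hC0.ne'

/-- Green's formula. -/
lemma energy_eq_inner_opA {v χ : L2 Ω} (hv : v ∈ H2 Ω) (hχ : χ ∈ H10 Ω) :
    energy ⟨v, hv.1⟩ ⟨χ, hχ.1⟩ = inner ℝ (opA v) χ := by
  rw [energy, PiLp.inner_apply, opA, inner_neg_left, sum_inner, ← Finset.sum_neg_distrib]
  exact Finset.sum_congr rfl fun i _ => inner_weakPartial_eq_neg (hv.2 i) hχ i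

/-- `A_h R_h v` is the `L²`-projection of `A v`. -/
lemma norm_Ah_Rh_le (𝒯 : Triangulation Ω) {v : L2 Ω} (hv : v ∈ H2 Ω) (hv' : v ∈ H10 Ω) :
    ‖Ah 𝒯 (Rh 𝒯 ⟨v, hv'⟩)‖ ≤ ‖opA v‖ := by
  set z := Ah 𝒯 (Rh 𝒯 ⟨v, hv'⟩) with hz
  have h1 : inner ℝ z z = inner ℝ (opA v) (z : L2 Ω) := by
    nth_rewrite 1 [hz]
    rw [Ah_spec, Rh_spec]
    exact energy_eq_inner_opA hv z.2.1
  have h2 : ‖z‖ * ‖z‖ ≤ ‖opA v‖ * ‖z‖ := by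
    rw [← real_inner_self_eq_norm_mul_norm, h1]
    exact real_inner_le_norm _ _
  rcases (norm_nonneg z).eq_or_lt with h | h
  · rw [← h]
    exact norm_nonneg _
  · exact le_of_mul_le_mul_right h2 h

lemma isSymmetric_Ah (𝒯 : Triangulation Ω) : (Ah 𝒯 : Xh 𝒯 →ₗ[ℝ] Xh 𝒯).IsSymmetric := by
  intro x y
  change inner ℝ (Ah 𝒯 x) y = inner ℝ x (Ah 𝒯 y)
  rw [Ah_spec, real_inner_comm, Ah_spec]
  exact real_inner_comm _ _

lemma inner_Ah_self_nonneg (𝒯 : Triangulation Ω) (x : Xh 𝒯) : 0 ≤ inner ℝ (Ah 𝒯 x) x := by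
  rw [Ah_spec]
  exact real_inner_self_nonneg

end Subdiffusion

theorem mainTheorem3 (α : ℝ) (hα₀ : 0 < α) (hα₁ : α < 1) :
    ∃ c : ℝ, 0 < c ∧
      ∀ (d : ℕ) (_ : 1 ≤ d) (_ : d ≤ 3) (Ω : Opens (Space d)) (_ : IsConvexPolygonalDomain Ω)
        (𝒯 : Triangulation Ω) (T : ℝ) (_ : 0 < T) (N : ℕ) (_ : 1 ≤ N)
        (v : L2 Ω) (_ : v ∈ H2 Ω) (hv : v ∈ H10 Ω)
        (u : ℝ → Xh 𝒯) (U : ℕ → Xh 𝒯),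
        IsSemidiscreteSolution 𝒯 α T 0 (Rh 𝒯 ⟨v, hv⟩) u →
        IsFullyDiscreteSolution 𝒯 α (T / N) N 0 (Rh 𝒯 ⟨v, hv⟩) U →
        ∀ n : ℕ, 1 ≤ n → n ≤ N →
          ‖(u (n * (T / N)) : L2 Ω) - (U n : L2 Ω)‖ ≤
            c * (T / N) * (n * (T / N)) ^ (α - 1) * ‖opA v‖ := by
  refine ⟨errorConst α, errorConst_pos hα₀ hα₁, ?_⟩
  intro d _ _ Ω _ 𝒯 T hT N _ v hv2 hv u U hu hU n hn hnN
  have h := norm_caputo_sub_scheme_le (isSymmetric_Ah 𝒯) (inner_Ah_self_nonneg 𝒯) hα₀ hα₁ hT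
    (N := N) (U := U) hu.continuousOn hu.differentiableAt hu.integrable
    (fun t ht => by simpa using hu.equation t ht)
    (fun m hm hmN => by simpa using hU.equation m hm hmN)
    (hu.initial.trans hU.initial.symm) hn hnN
  rw [hU.initial] at h
  refine h.trans (mul_le_mul_of_nonneg_left (norm_Ah_Rh_le 𝒯 hv2 hv) ?_)
  have := errorConst_pos hα₀ hα₁
  positivity
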